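/- Let $\mathcal Q$ be a small quantaloid, i.e. a small category whose hom-sets are complete lattices and whose composition preserves arbitrary joins in each variable; $u\swarrow v$ denotes the largest arrow $w$ with $w\circ v\le u$. All sets below are small. A $\mathcal Q$-category $\mathbb X$ is a set $\mathbb X_0$ with a type $|x|\in\mathrm{ob}\,\mathcal Q$ for each $x\in\mathbb X_0$ and arrows $\mathbb X(x,y):|x|\to|y|$ with $1_{|x|}\le\mathbb X(x,x)$ and $\mathbb X(y,z)\circ\mathbb X(x,y)\le\mathbb X(x,z)$; it is discrete if $\mathbb X(x,x)=1_{|x|}$ and $\mathbb X(x,y)=\bot$ for $x\ne y$. Write $x\le y$ if $|x|=|y|$ and $1_{|x|}\le\mathbb X(x,y)$; $\mathbb X$ is separated if $x\le y\le x$ implies $x=y$. A $\mathcal Q$-functor $f:\mathbb X\to\mathbb Y$ is a type-preserving map with $\mathbb X(x,x')\le\mathbb Y(fx,fx')$; $\mathcal Q$-functors are ordered pointwise. A $\mathcal Q$-closure operator is a $\mathcal Q$-functor $c:\mathbb X\to\mathbb X$ with $x\le cx$ and $ccx\le cx$. A $\mathcal Q$-distributor $\zeta:\mathbb X\nrightarrow\mathbb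 Y$ is a family of arrows $\zeta(x,y):|x|\to|y|$ with $\mathbb Y(y,y')\circ\zeta(x,y)\circ\mathbb X(x',x)\le\zeta(x',y')$. Distributors are ordered pointwise, and composed by $(\eta\circ\zeta)(x,z)=\bigvee_y\eta(y,z)\circ\zeta(x,y)$. A presheaf on $\mathbb X$ of type $q$ is a family of arrows $\mu(x):|x|\to q$ with $\mu(x)\circ\mathbb X(x',x)\le\mu(x')$. Presheaves form a $\mathcal Q$-category $\mathsf P\mathbb X$ with $\mathsf P\mathbb X(\mu,\mu')=\bigwedge_x\mu'(x)\swarrow\mu(x)$, and $\zeta$ induces $\zeta^*:\mathsf P\mathbb Y\to\mathsf P\mathbb X$, $(\zeta^*\lambda)(x)=\bigvee_y\lambda(y)\circ\zeta(x,y)$. A $\mathcal Q$-closure space $(\mathbb X,c)$ is a $\mathcal Q$-category $\mathbb X$ with a $\mathcal Q$-closure operator $c$ on $\mathsf P\mathbb X$. A distributor $\zeta$ is continuous from $(\mathbb X,c)$ to $(\mathbb Y,d)$ if $\zeta^*d\le c\,\zeta^*$, and closed if moreover $c(\zeta(-,y))=\zeta(-,y)$ for all $y$. Its closure is given by $(\mathrm{cl}\,\zeta)(-,y)=c(\zeta(-,y))$.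 Let $\mathcal Q\text{-}\mathbf{ClsCloDist}$ be the quantaloid of $\mathcal Q$-closure spaces and closed continuous distributors, with composition $\mathrm{cl}(\eta\circ\zeta)$, identities $\mathrm{cl}(\mathbb X)$ (the closure of the identity distributor $\mathbb X(-,-)$) and joins $\mathrm{cl}(\bigvee_i\zeta_i)$. Let $\mathcal Q\text{-}\mathbf{ClsCloRel}$ be its full subquantaloid on the closure spaces whose underlying $\mathcal Q$-category is discrete. A supremum of $\mu\in\mathsf P\mathbb X$ is an $s\in\mathbb X_0$ with $|s|=|\mu|$ and $\mathbb X(s,y)=\bigwedge_x\mathbb X(x,y)\swarrow\mu(x)$ for all $y$; $\mathbb X$ is complete if all presheaves on it have suprema. A $\mathcal Q$-functor $f:\mathbb X\to\mathbb Y$ is sup-preserving if, whenever $s$ is a supremum of $\mu$, $fs$ is a supremum of the presheaf $y\mapsto\bigvee_x\mu(x)\circ\mathbb Y(y,fx)$. Let $\mathcal Q\text{-}\mathbf{Sup}$ be the quantaloid of separated complete $\mathcal Q$-categories and sup-preserving $\mathcal Q$-functors, with the pointwise order. An equivalence of quantaloids is a functor that preserves all joins of arrows and is an equivalence of the underlying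 categories; the opposite of a quantaloid carries the same order on its arrows. **Theorem.** The inclusion $\mathcal Q\text{-}\mathbf{ClsCloRel}\hookrightarrow\mathcal Q\text{-}\mathbf{ClsCloDist}$ is an equivalence of quantaloids, and these two quantaloids are equivalent. Hence there are equivalences of quantaloids $$\mathcal Q\text{-}\mathbf{ClsCloRel}^{\mathrm{op}}\simeq\mathcal Q\text{-}\mathbf{ClsCloDist}^{\mathrm{op}}\simeq\mathcal Q\text{-}\mathbf{Sup}.$$ In particular, the category $\mathcal Q\text{-}\mathbf{ClsCloRel}$ has all small limits and all small colimits. -/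

import Mathlib

open CategoryTheory

universe u v w

namespace QClo

/-! ## Quantaloids, homomorphisms, nuclei -/

/-- A quantaloid: a category whose hom-sets are complete lattices and whose composition preserves
joins in each variable. -/
class Quantaloid (C : Type w) [Category.{v} C] where
  homLattice : ∀ p q : C, CompleteLattice (p ⟶ q)
  comp_sSup : ∀ {p q r : C} (f : p ⟶ q) (S : Set (q ⟶ r)), f ≫ sSup S = ⨆ g ∈ S, f ≫ g
  sSup_comp : ∀ {p q r : C} (S : Set (p ⟶ q)) (g : q ⟶ r), sSup S ≫ g = ⨆ f ∈ S, f ≫ g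

attribute [instance] Quantaloid.homLattice

/-- A functor between quantaloids is a homomorphism if it preserves all joins of arrows. -/
def IsQuantaloidHom {C : Type*} [Category C] [Quantaloid C] {D : Type*} [Category D]
    [Quantaloid D] (F : C ⥤ D) : Prop :=
  ∀ {p q : C} (S : Set (p ⟶ q)), F.map (sSup S) = ⨆ f ∈ S, F.map f

/-- An equivalence of quantaloids is a homomorphism whose underlying functor is an equivalence of
categories. -/
def IsQuantaloidEquivalence {C : Type*} [Category C] [Quantaloid C] {D : Type*} [Category D]
    [Quantaloid D] (F : C ⥤ D) : Prop :=
  IsQuantaloidHom F ∧ F.IsEquivalence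

/-- `C ≃ D` as quantaloids. -/
def QuantaloidEquivalent (C : Type*) [Category C] [Quantaloid C] (D : Type*) [Category D]
    [Quantaloid D] : Prop :=
  ∃ F : C ⥤ D, IsQuantaloidEquivalence F

/-- Transport of a complete lattice structure along a bijection. -/
abbrev liftLattice {α β : Type*} [CompleteLattice β] (e : α ≃ β) : CompleteLattice α :=
  letI : PartialOrder α := PartialOrder.lift e e.injective
  letI : SupSet α := ⟨fun S => e.symm (sSup (e '' S))⟩
  completeLatticeOfSup α fun S => by
    constructor
    · intro a ha
      change e a ≤ e (e.symm _)
      rw [e.apply_symm_apply]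
      exact le_sSup ⟨a, ha, rfl⟩
    · intro b hb
      change e (e.symm _) ≤ e b
      rw [e.apply_symm_apply]
      apply sSup_le
      rintro _ ⟨a, ha, rfl⟩
      exact hb ha

section Basic

variable {C : Type w} [Category.{v} C] [Quantaloid C] {p q r : C}

instance opHomLattice (a b : Cᵒᵖ) : CompleteLattice (a ⟶ b) :=
  liftLattice (opEquiv a b)

instance fullHomLattice (P : ObjectProperty C) (a b : P.FullSubcategory) :
    CompleteLattice (a ⟶ b) :=
  liftLattice (β := a.obj ⟶ b.obj) InducedCategory.homEquiv

/-- The opposite quantaloid: `C` with arrows reversed and the same order on them. -/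
instance : Quantaloid Cᵒᵖ where
  homLattice a b := opHomLattice a b
  comp_sSup {a b c} f S := by
    refine IsLUB.unique ?_ (isLUB_biSup)
    have e : (f ≫ sSup S).unop = ⨆ h ∈ (opEquiv b c) '' S, h ≫ f.unop :=
      Quantaloid.sSup_comp _ _
    constructor
    · rintro _ ⟨g, hg, rfl⟩
      change g.unop ≫ f.unop ≤ (f ≫ sSup S).unop
      rw [e]
      exact le_iSup₂ (f := fun (h : c.unop ⟶ b.unop) (_ : h ∈ (opEquiv b c) '' S) => h ≫ f.unop)
        g.unop ⟨g, hg, rfl⟩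
    · intro h hh
      change (f ≫ sSup S).unop ≤ h.unop
      rw [e]
      refine iSup₂_le ?_
      rintro _ ⟨g, hg, rfl⟩
      exact hh ⟨g, hg, rfl⟩
  sSup_comp {a b c} S g := by
    refine IsLUB.unique ?_ (isLUB_biSup)
    have e : (sSup S ≫ g).unop = ⨆ h ∈ (opEquiv a b) '' S, g.unop ≫ h :=
      Quantaloid.comp_sSup _ _
    constructor
    · rintro _ ⟨f, hf, rfl⟩
      change g.unop ≫ f.unop ≤ (sSup S ≫ g).unop
      rw [e]
      exact le_iSup₂ (f := fun (h : b.unop ⟶ a.unop) (_ : h ∈ (opEquiv a b) '' S) => g.unop ≫ h)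
        f.unop ⟨f, hf, rfl⟩
    · intro h hh
      change (sSup S ≫ g).unop ≤ h.unop
      rw [e]
      refine iSup₂_le ?_
      rintro _ ⟨f, hf, rfl⟩
      exact hh ⟨f, hf, rfl⟩

/-- A full subcategory of a quantaloid, with the inherited order on arrows. -/
instance (P : ObjectProperty C) : Quantaloid P.FullSubcategory where
  homLattice a b := fullHomLattice P a b
  comp_sSup {a b c} f S := by
    refine IsLUB.unique ?_ (isLUB_biSup)
    have e : (f ≫ sSup S).hom =
        ⨆ h ∈ (fun g : b ⟶ c => (g.hom : b.obj ⟶ c.obj)) '' S, f.hom ≫ h :=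
      Quantaloid.comp_sSup _ _
    constructor
    · rintro _ ⟨g, hg, rfl⟩
      change f.hom ≫ g.hom ≤ (f ≫ sSup S).hom
      rw [e]
      exact le_iSup₂ (f := fun (h : b.obj ⟶ c.obj)
        (_ : h ∈ (fun g : b ⟶ c => (g.hom : b.obj ⟶ c.obj)) '' S) => f.hom ≫ h) g.hom ⟨g, hg, rfl⟩
    · intro h hh
      change (f ≫ sSup S).hom ≤ h.hom
      rw [e]
      refine iSup₂_le ?_
      rintro _ ⟨g, hg, rfl⟩
      exact hh ⟨g, hg, rfl⟩
  sSup_comp {a b c} S g := by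
    refine IsLUB.unique ?_ (isLUB_biSup)
    have e : (sSup S ≫ g).hom =
        ⨆ h ∈ (fun f : a ⟶ b => (f.hom : a.obj ⟶ b.obj)) '' S, h ≫ g.hom :=
      Quantaloid.sSup_comp _ _
    constructor
    · rintro _ ⟨f, hf, rfl⟩
      change f.hom ≫ g.hom ≤ (sSup S ≫ g).hom
      rw [e]
      exact le_iSup₂ (f := fun (h : a.obj ⟶ b.obj)
        (_ : h ∈ (fun f : a ⟶ b => (f.hom : a.obj ⟶ b.obj)) '' S) => h ≫ g.hom) f.hom ⟨f, hf, rfl⟩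
    · intro h hh
      change (sSup S ≫ g).hom ≤ h.hom
      rw [e]
      refine iSup₂_le ?_
      rintro _ ⟨f, hf, rfl⟩
      exact hh ⟨f, hf, rfl⟩

theorem comp_iSup {ι : Sort*} (f : p ⟶ q) (g : ι → (q ⟶ r)) :
    f ≫ (⨆ i, g i) = ⨆ i, f ≫ g i := by
  rw [iSup, Quantaloid.comp_sSup, iSup_range]

theorem iSup_comp {ι : Sort*} (f : ι → (p ⟶ q)) (g : q ⟶ r) :
    (⨆ i, f i) ≫ g = ⨆ i, f i ≫ g := by
  rw [iSup, Quantaloid.sSup_comp, iSup_range]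

theorem comp_mono {f f' : p ⟶ q} {g g' : q ⟶ r} (hf : f ≤ f') (hg : g ≤ g') :
    f ≫ g ≤ f' ≫ g' := by
  have h1 : f ≫ g ≤ f' ≫ g := by
    have : f' ≫ g = ⨆ x ∈ ({f, f'} : Set (p ⟶ q)), x ≫ g := by
      rw [← Quantaloid.sSup_comp, sSup_pair, sup_eq_right.2 hf]
    rw [this]
    exact le_iSup₂ (f := fun x (_ : x ∈ ({f, f'} : Set (p ⟶ q))) => x ≫ g) f (by simp)
  have h2 : f' ≫ g ≤ f' ≫ g' := by
    have : f' ≫ g' = ⨆ x ∈ ({g, g'} : Set (q ⟶ r)), f' ≫ x := by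
      rw [← Quantaloid.comp_sSup, sSup_pair, sup_eq_right.2 hg]
    rw [this]
    exact le_iSup₂ (f := fun x (_ : x ∈ ({g, g'} : Set (q ⟶ r))) => f' ≫ x) g (by simp)
  exact h1.trans h2

/-- The implication `g ↙ f : q ⟶ r` of arrows `f : p ⟶ q` and `g : p ⟶ r`: the largest `h` such that
`f` followed by `h` is below `g`. -/
def imp (f : p ⟶ q) (g : p ⟶ r) : q ⟶ r :=
  sSup {h | f ≫ h ≤ g}

theorem le_imp {f : p ⟶ q} {g : p ⟶ r} {h : q ⟶ r} : h ≤ imp f g ↔ f ≫ h ≤ g := by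
  constructor
  · intro H
    refine (comp_mono le_rfl H).trans ?_
    rw [imp, Quantaloid.comp_sSup]
    exact iSup₂_le fun _ h => h
  · intro H
    exact le_sSup H

end Basic

/-- A nucleus on a quantaloid: a closure operator on each hom-set, lax with respect to
composition. -/
structure Nucleus (C : Type w) [Category.{v} C] [Quantaloid C] where
  app : ∀ {p q : C}, (p ⟶ q) → (p ⟶ q)
  mono : ∀ {p q : C} {f g : p ⟶ q}, f ≤ g → app f ≤ app g
  le_app : ∀ {p q : C} (f : p ⟶ q), f ≤ app f
  idem : ∀ {p q : C} (f : p ⟶ q), app (app f) = app f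
  comp_le : ∀ {p q r : C} (f : p ⟶ q) (g : q ⟶ r), app f ≫ app g ≤ app (f ≫ g)

namespace Nucleus

variable {C : Type w} [Category.{v} C] [Quantaloid C] (j : Nucleus C)

/-- The quotient quantaloid of a nucleus: the objects are those of `C`, the arrows are the fixed
points of the nucleus. -/
@[ext]
structure Quotient (j : Nucleus C) where
  obj : C

theorem app_comp_left {p q r : C} (f : p ⟶ q) (g : q ⟶ r) :
    j.app (j.app f ≫ g) = j.app (f ≫ g) := by
  apply le_antisymm
  · rw [← j.idem (f ≫ g)]
    exact j.mono ((comp_mono le_rfl (j.le_app g)).trans (j.comp_le f g))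
  · exact j.mono (comp_mono (j.le_app f) le_rfl)

theorem app_comp_right {p q r : C} (f : p ⟶ q) (g : q ⟶ r) :
    j.app (f ≫ j.app g) = j.app (f ≫ g) := by
  apply le_antisymm
  · rw [← j.idem (f ≫ g)]
    exact j.mono ((comp_mono (j.le_app f) le_rfl).trans (j.comp_le f g))
  · exact j.mono (comp_mono le_rfl (j.le_app g))

instance : Category.{v} j.Quotient where
  Hom X Y := {f : X.obj ⟶ Y.obj // j.app f = f}
  id X := ⟨j.app (𝟙 X.obj), j.idem _⟩
  comp f g := ⟨j.app (f.1 ≫ g.1), j.idem _⟩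
  id_comp f := Subtype.ext (by
    change j.app (j.app (𝟙 _) ≫ f.1) = f.1
    rw [j.app_comp_left, Category.id_comp, f.2])
  comp_id f := Subtype.ext (by
    change j.app (f.1 ≫ j.app (𝟙 _)) = f.1
    rw [j.app_comp_right, Category.comp_id, f.2])
  assoc f g h := Subtype.ext (by
    change j.app (j.app (f.1 ≫ g.1) ≫ h.1) = j.app (f.1 ≫ j.app (g.1 ≫ h.1))
    rw [j.app_comp_left, j.app_comp_right, Category.assoc])

instance (X Y : j.Quotient) : PartialOrder (X ⟶ Y) :=
  inferInstanceAs (PartialOrder {f : X.obj ⟶ Y.obj // j.app f = f})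

/-- Joins in the quotient are the nucleus applied to the joins in `C`. -/
instance (X Y : j.Quotient) : SupSet (X ⟶ Y) :=
  ⟨fun S => ⟨j.app (⨆ f ∈ S, f.1), j.idem _⟩⟩

theorem isLUB_sSup (X Y : j.Quotient) (S : Set (X ⟶ Y)) : IsLUB S (sSup S) := by
  constructor
  · intro f hf
    change f.1 ≤ j.app (⨆ f ∈ S, f.1)
    exact (le_iSup₂ (f := fun (f : X ⟶ Y) (_ : f ∈ S) => f.1) f hf).trans (j.le_app _)
  · intro g hg
    change j.app (⨆ f ∈ S, f.1) ≤ g.1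
    rw [← g.2]
    exact j.mono (iSup₂_le fun f hf => hg hf)

instance (X Y : j.Quotient) : CompleteLattice (X ⟶ Y) :=
  completeLatticeOfSup (X ⟶ Y) (j.isLUB_sSup X Y)

instance : Quantaloid j.Quotient where
  homLattice X Y := inferInstance
  comp_sSup {X Y Z} f S := by
    refine IsLUB.unique ?_ (isLUB_biSup)
    constructor
    · rintro _ ⟨g, hg, rfl⟩
      exact j.mono (comp_mono le_rfl ((j.isLUB_sSup Y Z S).1 hg))
    · intro h hh
      change j.app (f.1 ≫ j.app (⨆ g ∈ S, g.1)) ≤ h.1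
      rw [j.app_comp_right, ← h.2]
      apply j.mono
      simp only [comp_iSup]
      refine iSup₂_le fun g hg => (j.le_app _).trans ?_
      exact hh ⟨g, hg, rfl⟩
  sSup_comp {X Y Z} S g := by
    refine IsLUB.unique ?_ (isLUB_biSup)
    constructor
    · rintro _ ⟨f, hf, rfl⟩
      exact j.mono (comp_mono ((j.isLUB_sSup X Y S).1 hf) le_rfl)
    · intro h hh
      change j.app (j.app (⨆ g ∈ S, g.1) ≫ g.1) ≤ h.1
      rw [j.app_comp_left, ← h.2]
      apply j.mono
      simp only [iSup_comp]
      refine iSup₂_le fun f hf => (j.le_app _).trans ?_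
      exact hh ⟨f, hf, rfl⟩

end Nucleus

/-! ## Categories, functors, distributors and presheaves enriched in a small quantaloid

A set `X` with a type map `X → Q` on the objects of `Q` is given by the family of its fibres,
`obj q` being the set of the elements of type `q`; the underlying set is `Σ q, obj q`. A
type-preserving map is then a family of maps between fibres. -/

/-- A `Q`-category: `hom x y` is the arrow `X(x, y) : |x| ⟶ |y|`. -/
structure QCat (Q : Type u) [SmallCategory Q] [Quantaloid Q] where
  obj : Q → Type u
  hom : ∀ {p q : Q}, obj p → obj q → (p ⟶ q)
  id_le : ∀ {p : Q} (x : obj p), 𝟙 p ≤ hom x x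
  comp_le : ∀ {p q r : Q} (x : obj p) (y : obj q) (z : obj r), hom x y ≫ hom y z ≤ hom x z

variable {Q : Type u} [SmallCategory Q] [Quantaloid Q]

namespace QCat

/-- The underlying preorder on the elements of a given type. -/
def le (X : QCat Q) {q : Q} (x y : X.obj q) : Prop :=
  𝟙 q ≤ X.hom x y

/-- Separated `Q`-categories. -/
def IsSeparated (X : QCat Q) : Prop :=
  ∀ {q : Q} (x y : X.obj q), X.le x y → X.le y x → x = y

open Classical in
/-- Discrete `Q`-categories: `X(x, y)` is the identity if `x = y`, and the bottom arrow otherwise.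
Equality is that of the underlying set `Σ q, X.obj q`. -/
def IsDiscrete (X : QCat Q) : Prop :=
  ∀ {p q : Q} (x : X.obj p) (y : X.obj q),
    X.hom x y =
      if h : (⟨p, x⟩ : Σ q, X.obj q) = ⟨q, y⟩ then eqToHom (congrArg Sigma.fst h) else ⊥

end QCat

/-- A presheaf of type `q` on `X`: a distributor from `X` to the one-object discrete `Q`-category
whose object has type `q`. -/
@[ext]
structure Presheaf (X : QCat Q) (q : Q) where
  val : ∀ {p : Q}, X.obj p → (p ⟶ q)
  hom_comp_le : ∀ {p p' : Q} (x : X.obj p) (x' : X.obj p'), X.hom x x' ≫ val x' ≤ val x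

/-- The `Q`-category of presheaves, with `PX(μ, μ')` the meet of the `μ'(x) ↙ μ(x)`. -/
abbrev presheafCat (X : QCat Q) : QCat Q where
  obj q := Presheaf X q
  hom μ μ' := ⨅ (p : Q) (x : X.obj p), imp (μ.val x) (μ'.val x)
  id_le μ := le_iInf₂ fun _ _ => le_imp.2 (by rw [Category.comp_id])
  comp_le μ₁ μ₂ μ₃ := le_iInf₂ fun p x => le_imp.2 (by
    rw [← Category.assoc]
    refine (comp_mono (le_imp.1 (iInf₂_le p x)) le_rfl).trans ?_
    exact le_imp.1 (iInf₂_le p x))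

theorem le_presheaf_hom {X : QCat Q} {q r : Q} {μ : Presheaf X q} {μ' : Presheaf X r}
    {f : q ⟶ r} :
    f ≤ (presheafCat X).hom μ μ' ↔ ∀ ⦃p : Q⦄ (x : X.obj p), μ.val x ≫ f ≤ μ'.val x := by
  simp only [le_iInf_iff, le_imp]

theorem presheaf_le_iff {X : QCat Q} {q : Q} {μ μ' : Presheaf X q} :
    (presheafCat X).le μ μ' ↔ ∀ ⦃p : Q⦄ (x : X.obj p), μ.val x ≤ μ'.val x := by
  refine (le_presheaf_hom (f := 𝟙 q)).trans ?_
  simp only [Category.comp_id]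

theorem presheaf_le_antisymm {X : QCat Q} {q : Q} {μ μ' : Presheaf X q}
    (h : (presheafCat X).le μ μ') (h' : (presheafCat X).le μ' μ) : μ = μ' := by
  ext p x
  exact le_antisymm (presheaf_le_iff.1 h x) (presheaf_le_iff.1 h' x)

/-- `Q`-functors. -/
@[ext]
structure QFunctor (X Y : QCat Q) where
  map : ∀ {q : Q}, X.obj q → Y.obj q
  hom_le : ∀ {p q : Q} (x : X.obj p) (x' : X.obj q), X.hom x x' ≤ Y.hom (map x) (map x')

/-- `Q`-distributors from `X` to `Y`. -/
@[ext]
structure QDistributor (X Y : QCat Q) where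
  val : ∀ {p q : Q}, X.obj p → Y.obj q → (p ⟶ q)
  hom_comp_le : ∀ {p p' q q' : Q} (x' : X.obj p') (x : X.obj p) (y : Y.obj q) (y' : Y.obj q'),
    X.hom x' x ≫ val x y ≫ Y.hom y y' ≤ val x' y'

namespace QDistributor

variable {X Y Z : QCat Q}

theorem left_le (φ : QDistributor X Y) {p p' q : Q} (x' : X.obj p') (x : X.obj p)
    (y : Y.obj q) : X.hom x' x ≫ φ.val x y ≤ φ.val x' y := by
  refine le_trans ?_ (φ.hom_comp_le x' x y y)
  refine comp_mono le_rfl ?_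
  conv_lhs => rw [← Category.comp_id (φ.val x y)]
  exact comp_mono le_rfl (Y.id_le y)

theorem right_le (φ : QDistributor X Y) {p q q' : Q} (x : X.obj p)
    (y : Y.obj q) (y' : Y.obj q') : φ.val x y ≫ Y.hom y y' ≤ φ.val x y' := by
  refine le_trans ?_ (φ.hom_comp_le x x y y')
  conv_lhs => rw [← Category.id_comp (φ.val x y ≫ _)]
  exact comp_mono (X.id_le x) le_rfl

/-- The identity distributor, given by the hom-arrows. -/
def id (X : QCat Q) : QDistributor X X where
  val x y := X.hom x y
  hom_comp_le x' x y y' := (comp_mono le_rfl (X.comp_le x y y')).trans (X.comp_le x' x y')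

/-- The composite `φ` followed by `ψ`. -/
def comp (φ : QDistributor X Y) (ψ : QDistributor Y Z) : QDistributor X Z where
  val x z := ⨆ (q : Q) (y : Y.obj q), φ.val x y ≫ ψ.val y z
  hom_comp_le x' x z z' := by
    simp only [comp_iSup, iSup_comp]
    refine iSup₂_le fun q y => le_trans ?_ (le_iSup₂ q y)
    rw [Category.assoc, ← Category.assoc]
    exact comp_mono (φ.left_le x' x y) (ψ.right_le y z z')

/-- The transpose: the presheaf `φ(-, y)` on `X`, for `y` in `Y`. -/
def transpose (φ : QDistributor X Y) {q : Q} (y : Y.obj q) : Presheaf X q where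
  val x := φ.val x y
  hom_comp_le x x' := φ.left_le x x' y

/-- The map `φ^* : PY → PX`, composition with `φ`. -/
def star (φ : QDistributor X Y) {r : Q} (l : Presheaf Y r) : Presheaf X r where
  val x := ⨆ (q : Q) (y : Y.obj q), φ.val x y ≫ l.val y
  hom_comp_le x x' := by
    simp only [comp_iSup]
    refine iSup₂_le fun q y => le_trans ?_ (le_iSup₂ q y)
    rw [← Category.assoc]
    exact comp_mono (φ.left_le x x' y) le_rfl

theorem star_le_iff (φ : QDistributor X Y) {r : Q} {l : Presheaf Y r} {μ : Presheaf X r} :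
    (presheafCat X).le (φ.star l) μ ↔
      ∀ {p q : Q} (x : X.obj p) (y : Y.obj q), φ.val x y ≫ l.val y ≤ μ.val x := by
  rw [presheaf_le_iff]
  simp only [star, iSup_le_iff]
  exact ⟨fun h p q x y => h x q y, fun h p x q y => h x y⟩

theorem star_comp (φ : QDistributor X Y) (ψ : QDistributor Y Z) {r : Q} (l : Presheaf Z r) :
    (φ.comp ψ).star l = φ.star (ψ.star l) := by
  ext p x
  simp only [star, comp, comp_iSup, iSup_comp, Category.assoc]
  apply le_antisymm
  · refine iSup₂_le fun q z => iSup₂_le fun r y => ?_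
    exact le_iSup₂_of_le r y (le_iSup₂_of_le q z le_rfl)
  · refine iSup₂_le fun q z => iSup₂_le fun r y => ?_
    exact le_iSup₂_of_le r y (le_iSup₂_of_le q z le_rfl)

theorem transpose_comp (φ : QDistributor X Y) (ψ : QDistributor Y Z) {r : Q} (z : Z.obj r) :
    (φ.comp ψ).transpose z = φ.star (ψ.transpose z) := rfl

theorem star_id {r : Q} (l : Presheaf X r) : (QDistributor.id X).star l = l := by
  ext p x
  apply le_antisymm
  · exact iSup₂_le fun q y => l.hom_comp_le x y
  · refine le_iSup₂_of_le p x ?_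
    conv_lhs => rw [← Category.id_comp (l.val x)]
    exact comp_mono (X.id_le x) le_rfl

theorem ext_transpose {φ ψ : QDistributor X Y}
    (h : ∀ {q : Q} (y : Y.obj q), φ.transpose y = ψ.transpose y) : φ = ψ := by
  ext p q x y
  exact congrArg (fun μ : Presheaf X q => μ.val x) (h y)

end QDistributor

/-! ## Closure spaces and continuous distributors -/

/-- A closure operator on a `Q`-category. -/
structure ClosureOp (X : QCat Q) extends QFunctor X X where
  le_map : ∀ {q : Q} (x : X.obj q), X.le x (map x)
  map_map_le : ∀ {q : Q} (x : X.obj q), X.le (map (map x)) (map x)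

variable (Q) in
/-- The objects of `Q-ClsDist`: a `Q`-closure space is a `Q`-category with a closure operator on its
`Q`-category of presheaves. -/
structure QClsDist where
  carrier : QCat Q
  cl : ClosureOp (presheafCat carrier)

namespace QClsDist

/-- The closure of a presheaf. -/
abbrev c (X : QClsDist Q) {q : Q} (μ : Presheaf X.carrier q) : Presheaf X.carrier q :=
  X.cl.map μ

variable {X Y Z : QClsDist Q}

theorem le_c {q : Q} (μ : Presheaf X.carrier q) {p : Q} (x : X.carrier.obj p) :
    μ.val x ≤ (X.c μ).val x :=
  presheaf_le_iff.1 (X.cl.le_map μ) x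

theorem c_c {q : Q} (μ : Presheaf X.carrier q) : X.c (X.c μ) = X.c μ :=
  presheaf_le_antisymm (X.cl.map_map_le μ) (X.cl.le_map _)

theorem c_comp_le {q r : Q} {μ : Presheaf X.carrier q} {ν : Presheaf X.carrier r} {f : q ⟶ r}
    (h : ∀ ⦃p : Q⦄ (x : X.carrier.obj p), μ.val x ≫ f ≤ ν.val x) {p : Q} (x : X.carrier.obj p) :
    (X.c μ).val x ≫ f ≤ (X.c ν).val x :=
  le_presheaf_hom.1 ((le_presheaf_hom.2 h).trans (X.cl.hom_le μ ν)) x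

theorem c_mono {q : Q} {μ ν : Presheaf X.carrier q}
    (h : ∀ ⦃p : Q⦄ (x : X.carrier.obj p), μ.val x ≤ ν.val x) {p : Q} (x : X.carrier.obj p) :
    (X.c μ).val x ≤ (X.c ν).val x := by
  have := c_comp_le (X := X) (μ := μ) (ν := ν) (f := 𝟙 q) (by simpa using h) x
  simpa using this

/-- A continuous distributor `ζ` from `(X, c)` to `(Y, d)`: a distributor with `ζ^* d ≤ c ζ^*`. -/
@[ext]
structure Hom (X Y : QClsDist Q) extends QDistributor X.carrier Y.carrier where
  continuous : ∀ {q : Q} (l : Presheaf Y.carrier q),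
    (presheafCat X.carrier).le (toQDistributor.star (Y.c l)) (X.c (toQDistributor.star l))

theorem hom_ext' {f g : Hom X Y} (h : f.toQDistributor = g.toQDistributor) : f = g := by
  cases f; cases g; cases h; rfl

theorem Hom.cont (f : Hom X Y) {r : Q} (l : Presheaf Y.carrier r) {p : Q}
    (x : X.carrier.obj p) : (f.star (Y.c l)).val x ≤ (X.c (f.star l)).val x :=
  presheaf_le_iff.1 (f.continuous l) x

theorem star_mono (φ : QDistributor X.carrier Y.carrier) {r : Q} {l l' : Presheaf Y.carrier r}
    (h : ∀ ⦃q : Q⦄ (y : Y.carrier.obj q), l.val y ≤ l'.val y) {p : Q} (x : X.carrier.obj p) :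
    (φ.star l).val x ≤ (φ.star l').val x :=
  iSup₂_mono fun _ y => comp_mono le_rfl (h y)

/-- `Q`-closure spaces and continuous `Q`-distributors form a category. -/
instance : Category.{u} (QClsDist Q) where
  Hom := Hom
  id X := ⟨QDistributor.id X.carrier, fun l => by
    simp only [QDistributor.star_id]
    exact (presheafCat X.carrier).id_le _⟩
  comp f g := ⟨f.toQDistributor.comp g.toQDistributor, fun l => by
    simp only [QDistributor.star_comp]
    refine presheaf_le_iff.2 fun _ x => ?_
    refine (star_mono f.toQDistributor (fun _ y => g.cont l y) x).trans ?_
    exact f.cont _ x⟩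
  id_comp f := hom_ext' (QDistributor.ext_transpose fun y => by
    rw [QDistributor.transpose_comp, QDistributor.star_id])
  comp_id {X Y} f := hom_ext' (by
    ext p q x y
    apply le_antisymm
    · exact iSup₂_le fun q' y' => f.right_le x y' y
    · refine le_iSup₂_of_le q y ?_
      conv_lhs => rw [← Category.comp_id (f.val x y)]
      exact comp_mono le_rfl (Y.carrier.id_le y))
  assoc f g h := hom_ext' (QDistributor.ext_transpose fun y => by
    simp only [QDistributor.transpose_comp, QDistributor.star_comp])

/-- The underlying distributor of a morphism of `Q-ClsDist`. -/
abbrev dist {X Y : QClsDist Q} (f : X ⟶ Y) : QDistributor X.carrier Y.carrier :=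
  Hom.toQDistributor f

theorem dist_cont {X Y : QClsDist Q} (f : X ⟶ Y) {r : Q} (l : Presheaf Y.carrier r) {p : Q}
    (x : X.carrier.obj p) : ((dist f).star (Y.c l)).val x ≤ (X.c ((dist f).star l)).val x :=
  Hom.cont f l x

theorem comp_val {X Y Z : QClsDist Q} (f : X ⟶ Y) (g : Y ⟶ Z) {p r : Q} (x : X.carrier.obj p)
    (z : Z.carrier.obj r) :
    (dist (f ≫ g)).val x z = ⨆ (q : Q) (y : Y.carrier.obj q), (dist f).val x y ≫ (dist g).val y z := rfl

/-- The pointwise order on continuous distributors. -/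
instance (X Y : QClsDist Q) : PartialOrder (X ⟶ Y) where
  le f g := ∀ ⦃p q : Q⦄ (x : X.carrier.obj p) (y : Y.carrier.obj q),
    (dist f).val x y ≤ (dist g).val x y
  le_refl _ _ _ _ _ := le_rfl
  le_trans _ _ _ h h' _ _ x y := (h x y).trans (h' x y)
  le_antisymm _ _ h h' := hom_ext' (by
    ext p q x y
    exact le_antisymm (h x y) (h' x y))

/-- Pointwise joins of continuous distributors. -/
instance (X Y : QClsDist Q) : SupSet (X ⟶ Y) where
  sSup S := Hom.mk
    { val := fun x y => ⨆ f ∈ S, (dist f).val x y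
      hom_comp_le := fun x' x y y' => by
        simp only [comp_iSup, iSup_comp]
        exact iSup₂_mono fun f _ => (dist f).hom_comp_le x' x y y' }
    fun l => by
        rw [QDistributor.star_le_iff]
        intro p q x y
        simp only [iSup_comp]
        refine iSup₂_le fun f hf => ?_
        refine le_trans (le_trans ?_ (dist_cont f l x)) ?_
        · exact le_iSup₂ (f := fun (q : Q) (y : Y.carrier.obj q) =>
            (dist f).val x y ≫ (Y.c l).val y) q y
        · refine c_mono (fun _ x => ?_) x
          exact iSup₂_mono fun q y => comp_mono (le_iSup₂ (f := fun (f : X ⟶ Y) (_ : f ∈ S) =>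
            (dist f).val _ y) f hf) le_rfl

theorem isLUB_sSup (X Y : QClsDist Q) (S : Set (X ⟶ Y)) : IsLUB S (sSup S) :=
  ⟨fun f hf _ _ x y => le_iSup₂ (f := fun (f : X ⟶ Y) (_ : f ∈ S) => (dist f).val x y) f hf,
    fun _ hg _ _ x y => iSup₂_le fun _ hf => hg hf x y⟩

instance (X Y : QClsDist Q) : CompleteLattice (X ⟶ Y) :=
  completeLatticeOfSup (X ⟶ Y) (isLUB_sSup X Y)

/-- The quantaloid `Q-ClsDist`. -/
instance : Quantaloid (QClsDist Q) where
  homLattice X Y := inferInstance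
  comp_sSup {X Y Z} f S := by
    refine IsLUB.unique ?_ (isLUB_biSup)
    constructor
    · rintro _ ⟨g, hg, rfl⟩ p r x z
      exact iSup₂_mono fun q y => comp_mono le_rfl ((isLUB_sSup Y Z S).1 hg y z)
    · intro h hh p r x z
      refine iSup₂_le fun q y => ?_
      change (dist f).val x y ≫ (⨆ g ∈ S, (dist g).val y z) ≤ _
      simp only [comp_iSup]
      refine iSup₂_le fun g hg => le_trans ?_ (hh ⟨g, hg, rfl⟩ x z)
      exact le_iSup₂ (f := fun (q : Q) (y : Y.carrier.obj q) => (dist f).val x y ≫ (dist g).val y z) q y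
  sSup_comp {X Y Z} S g := by
    refine IsLUB.unique ?_ (isLUB_biSup)
    constructor
    · rintro _ ⟨f, hf, rfl⟩ p r x z
      exact iSup₂_mono fun q y => comp_mono ((isLUB_sSup X Y S).1 hf x y) le_rfl
    · intro h hh p r x z
      refine iSup₂_le fun q y => ?_
      change (⨆ f ∈ S, (dist f).val x y) ≫ (dist g).val y z ≤ _
      simp only [iSup_comp]
      refine iSup₂_le fun f hf => le_trans ?_ (hh ⟨f, hf, rfl⟩ x z)
      exact le_iSup₂ (f := fun (q : Q) (y : Y.carrier.obj q) => (dist f).val x y ≫ (dist g).val y z) q y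

/-- The underlying distributor of the closure of `ζ`: its transpose is that of `ζ` followed by
the closure operator. -/
def clDist {X Y : QClsDist Q} (f : X ⟶ Y) : QDistributor X.carrier Y.carrier where
  val x y := (X.c ((dist f).transpose y)).val x
  hom_comp_le x' x y y' := by
    refine (comp_mono le_rfl (c_comp_le (fun _ x => ?_) x)).trans
      ((X.c ((dist f).transpose y')).hom_comp_le x' x)
    exact (dist f).right_le x y y'

theorem clDist_star_le {X Y : QClsDist Q} (f : X ⟶ Y) {r : Q} (l : Presheaf Y.carrier r) {p : Q}
    (x : X.carrier.obj p) :
    ((clDist f).star l).val x ≤ (X.c ((dist f).star l)).val x := by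
  refine iSup₂_le fun q y => c_comp_le (fun _ x => ?_) x
  exact le_iSup₂ (f := fun (q : Q) (y : Y.carrier.obj q) => (dist f).val x y ≫ l.val y) q y

theorem star_le_clDist {X Y : QClsDist Q} (f : X ⟶ Y) {r : Q} (l : Presheaf Y.carrier r) {p : Q}
    (x : X.carrier.obj p) :
    ((dist f).star l).val x ≤ ((clDist f).star l).val x :=
  iSup₂_mono fun _ y => comp_mono (le_c ((dist f).transpose y) x) le_rfl

/-- The closure of a continuous distributor. -/
def closure {X Y : QClsDist Q} (f : X ⟶ Y) : X ⟶ Y :=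
  Hom.mk (clDist f) fun l => presheaf_le_iff.2 fun _ x => by
    refine (clDist_star_le f _ x).trans ?_
    refine (c_mono (fun _ x => dist_cont f l x) x).trans ?_
    rw [c_c]
    exact c_mono (fun _ x => star_le_clDist f l x) x

/-- A continuous distributor is closed if its transpose takes values in closed presheaves. -/
def IsClosedDist {X Y : QClsDist Q} (f : X ⟶ Y) : Prop :=
  ∀ {q : Q} (y : Y.carrier.obj q),
    X.c ((dist f).transpose y) = (dist f).transpose y

/-- The fixed points of `closure` are the closed continuous distributors. -/
theorem closure_eq_iff {X Y : QClsDist Q} (f : X ⟶ Y) : closure f = f ↔ IsClosedDist f := by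
  constructor
  · intro h q y
    exact congrArg (fun g : X ⟶ Y => (dist g).transpose y) h
  · intro h
    exact hom_ext' (QDistributor.ext_transpose fun y => h y)

theorem isClosedDist_closure {X Y : QClsDist Q} (f : X ⟶ Y) : IsClosedDist (closure f) :=
  fun y => c_c ((dist f).transpose y)

variable (Q) in
/-- The nucleus on `Q-ClsDist` given by the closure of continuous distributors. -/
def clNucleus : Nucleus (QClsDist Q) where
  app := closure
  mono h _ _ x y := c_mono (fun _ x => h x y) x
  le_app f _ _ x y := le_c ((dist f).transpose y) x
  idem f := (closure_eq_iff _).2 (isClosedDist_closure f)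
  comp_le {X Y Z} f g p r x z := by
    change ((clDist f).star (Y.c ((dist g).transpose z))).val x ≤
      (X.c ((dist f).star ((dist g).transpose z))).val x
    refine (clDist_star_le f _ x).trans ?_
    refine (c_mono (fun _ x => dist_cont f _ x) x).trans ?_
    rw [c_c]

end QClsDist

variable (Q) in
/-- The quantaloid `Q-ClsCloDist` of `Q`-closure spaces and closed continuous `Q`-distributors: the
quotient of `Q-ClsDist` by the nucleus `cl`. -/
abbrev QClsCloDist := (QClsDist.clNucleus Q).Quotient

variable (Q) in
/-- The closure spaces whose underlying `Q`-category is discrete. -/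
def discreteClosureSpaces : ObjectProperty (QClsCloDist Q) :=
  fun X => X.obj.carrier.IsDiscrete

variable (Q) in
/-- The full subquantaloid `Q-ClsCloRel` of `Q-ClsCloDist`. -/
abbrev QClsCloRel := (discreteClosureSpaces Q).FullSubcategory

/-! ## Complete categories and sup-preserving functors -/

/-- `s` is a supremum of the presheaf `μ`: `X(s, -) = X ↙ μ`. -/
def IsSup (X : QCat Q) {q : Q} (μ : Presheaf X q) (s : X.obj q) : Prop :=
  ∀ {r : Q} (y : X.obj r), X.hom s y = ⨅ (p : Q) (x : X.obj p), imp (μ.val x) (X.hom x y)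

theorem isSup_iff {X : QCat Q} {q : Q} {μ : Presheaf X q} {s : X.obj q} :
    IsSup X μ s ↔ ∀ {r : Q} (y : X.obj r) (h : q ⟶ r),
      h ≤ X.hom s y ↔ ∀ {p : Q} (x : X.obj p), μ.val x ≫ h ≤ X.hom x y := by
  constructor
  · intro H r y h
    rw [H y]
    simp only [le_iInf_iff, le_imp]
  · intro H r y
    refine eq_of_forall_le_iff fun h => ?_
    rw [H y h]
    simp only [le_iInf_iff, le_imp]

/-- A `Q`-category is complete if every presheaf has a supremum. -/
def QCat.IsComplete (X : QCat Q) : Prop :=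
  ∀ {q : Q} (μ : Presheaf X q), ∃ s : X.obj q, IsSup X μ s

namespace QFunctor

variable {X Y Z : QCat Q}

/-- The direct image `f^→ μ`, the composite of `μ` with the cograph `Y(-, f-)` of `f`. -/
def push (f : QFunctor X Y) {q : Q} (μ : Presheaf X q) : Presheaf Y q where
  val y := ⨆ (p : Q) (x : X.obj p), Y.hom y (f.map x) ≫ μ.val x
  hom_comp_le y y' := by
    simp only [comp_iSup]
    refine iSup₂_mono fun p x => ?_
    rw [← Category.assoc]
    exact comp_mono (Y.comp_le y y' _) le_rfl

/-- `f` preserves suprema of presheaves. -/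
def IsSupPreserving (f : QFunctor X Y) : Prop :=
  ∀ {q : Q} (μ : Presheaf X q) (s : X.obj q), IsSup X μ s → IsSup Y (f.push μ) (f.map s)

theorem isSup_push_iff (f : QFunctor X Y) {q : Q} {μ : Presheaf X q} {t : Y.obj q} :
    IsSup Y (f.push μ) t ↔ ∀ {r : Q} (y : Y.obj r) (h : q ⟶ r),
      h ≤ Y.hom t y ↔ ∀ {p : Q} (x : X.obj p), μ.val x ≫ h ≤ Y.hom (f.map x) y := by
  rw [isSup_iff]
  refine forall_congr' fun r => forall_congr' fun y => forall_congr' fun h => ?_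
  refine iff_congr Iff.rfl ?_
  simp only [push, iSup_comp, iSup_le_iff, Category.assoc]
  constructor
  · intro H p x
    refine le_trans ?_ (H (f.map x) p x)
    conv_lhs => rw [← Category.id_comp (μ.val x ≫ h)]
    exact comp_mono (Y.id_le _) le_rfl
  · intro H p y' p' x
    exact (comp_mono le_rfl (H x)).trans (Y.comp_le _ _ _)

/-- The identity functor. -/
def id (X : QCat Q) : QFunctor X X := ⟨fun x => x, fun _ _ => le_rfl⟩

/-- The composite `f` followed by `g`. -/
def comp (f : QFunctor X Y) (g : QFunctor Y Z) : QFunctor X Z :=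
  ⟨fun x => g.map (f.map x), fun x x' => (f.hom_le x x').trans (g.hom_le _ _)⟩

theorem isSupPreserving_id (X : QCat Q) : (QFunctor.id X).IsSupPreserving :=
  fun _ _ h => (isSup_push_iff _).2 (isSup_iff.1 h)

theorem IsSupPreserving.comp {f : QFunctor X Y} {g : QFunctor Y Z} (hf : f.IsSupPreserving)
    (hg : g.IsSupPreserving) : (f.comp g).IsSupPreserving := by
  intro q μ s hs
  refine (isSup_push_iff _).2 fun z h => ?_
  rw [show (f.comp g).map s = g.map (f.map s) from rfl,
    (isSup_push_iff g).1 (hg _ _ (hf μ s hs)) z h]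
  simp only [push, iSup_comp, iSup_le_iff, Category.assoc]
  constructor
  · intro H p x
    refine le_trans ?_ (H (f.map x) p x)
    conv_lhs => rw [← Category.id_comp (μ.val x ≫ h)]
    exact comp_mono (Y.id_le _) le_rfl
  · intro H p y' p' x
    exact (comp_mono (g.hom_le _ _) (H x)).trans (Z.comp_le _ _ _)

end QFunctor

variable (Q) in
/-- The objects of `Q-Sup`: separated complete `Q`-categories. -/
structure QSup where
  carrier : QCat Q
  separated : carrier.IsSeparated
  complete : carrier.IsComplete

namespace QSup

/-- Sup-preserving functors. -/
@[ext]
structure Hom (X Y : QSup Q) extends QFunctor X.carrier Y.carrier where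
  sup_preserving : toQFunctor.IsSupPreserving

instance : Category.{u} (QSup Q) where
  Hom := Hom
  id X := ⟨QFunctor.id X.carrier, QFunctor.isSupPreserving_id _⟩
  comp f g := ⟨f.toQFunctor.comp g.toQFunctor, QFunctor.IsSupPreserving.comp f.sup_preserving g.sup_preserving⟩

theorem hom_ext' {X Y : QSup Q} {f g : Hom X Y} (h : f.toQFunctor = g.toQFunctor) : f = g := by
  cases f; cases g; cases h; rfl

/-- The underlying functor of a morphism of `Q-Sup`. -/
abbrev fn {X Y : QSup Q} (f : X ⟶ Y) : QFunctor X.carrier Y.carrier :=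
  Hom.toQFunctor f

theorem fn_sup {X Y : QSup Q} (f : X ⟶ Y) : (fn f).IsSupPreserving :=
  Hom.sup_preserving f

theorem comp_map {X Y Z : QSup Q} (f : X ⟶ Y) (g : Y ⟶ Z) {q : Q} (x : X.carrier.obj q) :
    (fn (f ≫ g)).map x = (fn g).map ((fn f).map x) := rfl

theorem carrier_le_trans (X : QCat Q) {q : Q} {x y z : X.obj q} (h : X.le x y) (h' : X.le y z) :
    X.le x z := by
  refine le_trans ?_ (X.comp_le x y z)
  conv_lhs => rw [← Category.comp_id (𝟙 q)]
  exact comp_mono h h'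

/-- The pointwise underlying order on sup-preserving functors. -/
instance (X Y : QSup Q) : PartialOrder (X ⟶ Y) where
  le f g := ∀ ⦃q : Q⦄ (x : X.carrier.obj q), Y.carrier.le ((fn f).map x) ((fn g).map x)
  le_refl _ _ _ := Y.carrier.id_le _
  le_trans _ _ _ h h' _ x := carrier_le_trans _ (h x) (h' x)
  le_antisymm _ _ h h' := hom_ext' (by
    ext q x
    exact Y.separated _ _ (h x) (h' x))

/-- The presheaf whose supremum is the join of a set of elements of type `q`. -/
def joinPresheaf (X : QCat Q) {q : Q} (S : Set (X.obj q)) : Presheaf X q where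
  val x := ⨆ y ∈ S, X.hom x y
  hom_comp_le x x' := by
    simp only [comp_iSup]
    exact iSup₂_mono fun y _ => X.comp_le x x' y

theorem joinPresheaf_comp_le_iff (X : QCat Q) {q : Q} (S : Set (X.obj q)) {r : Q} {h : q ⟶ r}
    {Y : QCat Q} (f : QFunctor X Y) (z : Y.obj r) :
    (∀ {p : Q} (x : X.obj p), (joinPresheaf X S).val x ≫ h ≤ Y.hom (f.map x) z) ↔
      ∀ y ∈ S, h ≤ Y.hom (f.map y) z := by
  simp only [joinPresheaf, iSup_comp, iSup_le_iff]
  constructor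
  · intro H y hy
    refine le_trans ?_ (H y y hy)
    conv_lhs => rw [← Category.id_comp h]
    exact comp_mono (X.id_le _) le_rfl
  · intro H p x y hy
    exact (comp_mono (f.hom_le x y) (H y hy)).trans (Y.comp_le _ _ _)

/-- The join of a set of elements of type `q`. -/
noncomputable def join (X : QSup Q) {q : Q} (S : Set (X.carrier.obj q)) : X.carrier.obj q :=
  (X.complete (joinPresheaf X.carrier S)).choose

theorem isSup_join (X : QSup Q) {q : Q} (S : Set (X.carrier.obj q)) :
    IsSup X.carrier (joinPresheaf X.carrier S) (X.join S) :=
  (X.complete (joinPresheaf X.carrier S)).choose_spec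

theorem le_join_hom (X : QSup Q) {q : Q} (S : Set (X.carrier.obj q)) {r : Q} {h : q ⟶ r}
    (z : X.carrier.obj r) :
    h ≤ X.carrier.hom (X.join S) z ↔ ∀ y ∈ S, h ≤ X.carrier.hom y z := by
  rw [isSup_iff.1 (X.isSup_join S) z h]
  exact joinPresheaf_comp_le_iff X.carrier S (QFunctor.id X.carrier) z

theorem le_map_join_hom {X Y : QSup Q} (f : X ⟶ Y) {q : Q} (S : Set (X.carrier.obj q)) {r : Q}
    {h : q ⟶ r} (z : Y.carrier.obj r) :
    h ≤ Y.carrier.hom ((fn f).map (X.join S)) z ↔ ∀ y ∈ S, h ≤ Y.carrier.hom ((fn f).map y) z := by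
  rw [(QFunctor.isSup_push_iff _).1 (fn_sup f _ _ (X.isSup_join S)) z h]
  exact joinPresheaf_comp_le_iff X.carrier S (fn f) z

theorem le_join (X : QSup Q) {q : Q} {S : Set (X.carrier.obj q)} {y : X.carrier.obj q}
    (hy : y ∈ S) : X.carrier.le y (X.join S) :=
  (X.le_join_hom S _).1 (X.carrier.id_le _) y hy

/-- Pointwise joins of sup-preserving functors. -/
noncomputable instance (X Y : QSup Q) : SupSet (X ⟶ Y) where
  sSup S := Hom.mk
    { map := fun x => Y.join ((fun f => (fn f).map x) '' S)
      hom_le := fun {p q} x x' => by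
        rw [le_join_hom]
        rintro _ ⟨f, hf, rfl⟩
        refine ((fn f).hom_le x x').trans (le_trans ?_ (Y.carrier.comp_le _ ((fn f).map x') _))
        conv_lhs => rw [← Category.comp_id (Y.carrier.hom _ _)]
        exact comp_mono le_rfl (Y.le_join ⟨f, hf, rfl⟩) }
    fun {q} μ s hs => by
        refine (QFunctor.isSup_push_iff _).2 fun {r} y h => ?_
        simp only [le_join_hom, Set.forall_mem_image]
        have key : ∀ {p : Q} (x : X.carrier.obj p),
            μ.val x ≫ h ≤ Y.carrier.hom (Y.join ((fun f => (fn f).map x) '' S)) y ↔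
              ∀ f ∈ S, μ.val x ≫ h ≤ Y.carrier.hom ((fn f).map x) y := by
          intro p x
          simp only [le_join_hom, Set.forall_mem_image]
        constructor
        · intro H p x f hf
          exact ((QFunctor.isSup_push_iff _).1 (fn_sup f μ s hs) y h).1 (H hf) x
        · intro H f hf
          exact ((QFunctor.isSup_push_iff _).1 (fn_sup f μ s hs) y h).2
            fun x => H x hf

theorem isLUB_sSup (X Y : QSup Q) (S : Set (X ⟶ Y)) : IsLUB S (sSup S) :=
  ⟨fun f hf _ _ => Y.le_join ⟨f, hf, rfl⟩, fun g hg q x =>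
    (Y.le_join_hom ((fun f => (fn f).map x) '' S) ((fn g).map x)).2 (by
      rintro _ ⟨f, hf, rfl⟩
      exact hg hf x)⟩

theorem map_mono {X Y : QSup Q} (f : X ⟶ Y) {q : Q} {x y : X.carrier.obj q}
    (h : X.carrier.le x y) : Y.carrier.le ((fn f).map x) ((fn f).map y) :=
  le_trans h ((fn f).hom_le x y)

noncomputable instance (X Y : QSup Q) : CompleteLattice (X ⟶ Y) :=
  completeLatticeOfSup (X ⟶ Y) (isLUB_sSup X Y)

/-- The quantaloid `Q-Sup`. -/
noncomputable instance : Quantaloid (QSup Q) where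
  homLattice X Y := inferInstance
  comp_sSup {X Y Z} f S := by
    refine IsLUB.unique ?_ (isLUB_biSup)
    constructor
    · rintro _ ⟨g, hg, rfl⟩ q x
      exact (isLUB_sSup Y Z S).1 hg ((fn f).map x)
    · intro h hh q x
      refine (Z.le_join_hom ((fun g => (fn g).map ((fn f).map x)) '' S) ((fn h).map x)).2 ?_
      rintro _ ⟨g, hg, rfl⟩
      exact hh ⟨g, hg, rfl⟩ x
  sSup_comp {X Y Z} S g := by
    refine IsLUB.unique ?_ (isLUB_biSup)
    constructor
    · rintro _ ⟨f, hf, rfl⟩ q x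
      exact map_mono g ((isLUB_sSup X Y S).1 hf x)
    · intro h hh q x
      refine (le_map_join_hom g ((fun f => (fn f).map x) '' S) ((fn h).map x)).2 ?_
      rintro _ ⟨f, hf, rfl⟩
      exact hh ⟨f, hf, rfl⟩ x

end QSup

end QClo

open QClo

/-! A closure space `X` is remembered, up to isomorphism in `QClsCloDist`, by its complete
`Q`-category of closed presheaves. A continuous `f : X ⟶ Y` induces `l ↦ c (f^* l)` from closed
presheaves on `Y` to closed presheaves on `X`. Continuity says exactly that the right adjoint of
`f^*` preserves closedness, so this map is a left adjoint and hence preserves suprema. It does not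
change when `f` is replaced by its closure, which gives the contravariant `closedPresheafFunctor`.

This functor is an order embedding on arrows: a closed `f` is read off from the values at closures
of representables (`closedStar_le_iff`). It is full: a sup-preserving `φ` is determined by those
values, since its right adjoint is (`c_distOfHom_star`). It is essentially surjective already on
discrete spaces: on the bare elements of a separated complete `A`, let the closure of `μ` be `A(-,
sup μ)`; the closed presheaves are then the restricted representables, a copy of `A`
(`isoClosedPresheaves`). So both the functor and its restriction to discrete spaces are
equivalences, and full faithfulness shows that every closure space is isomorphic to a discrete one.

Limits and colimits are built in `QSup` and transported. Products and equalizers are formed on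
elements. Coproducts are products, as in any quantaloid. The coequalizer of `f` and `g` is the
equalizer of their right adjoints, a reflective part of the codomain. -/

namespace QClo

/-! ### Order-enriched equivalences and biproducts in a quantaloid. -/

section Quantaloids

variable {C : Type*} [Category C] [Quantaloid C] {D : Type*} [Category D] [Quantaloid D]

theorem comp_bot {p q r : C} (f : p ⟶ q) : f ≫ (⊥ : q ⟶ r) = ⊥ := by
  simpa using Quantaloid.comp_sSup f (∅ : Set (q ⟶ r))

theorem bot_comp {p q r : C} (g : q ⟶ r) : (⊥ : p ⟶ q) ≫ g = ⊥ := by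
  simpa using Quantaloid.sSup_comp (∅ : Set (p ⟶ q)) g

theorem IsQuantaloidHom.map_le_map {F : C ⥤ D} (hF : IsQuantaloidHom F) {p q : C} {f g : p ⟶ q}
    (h : f ≤ g) : F.map f ≤ F.map g := by
  have e := hF {f, g}
  rw [sSup_pair, sup_eq_right.2 h] at e
  rw [e]
  exact le_iSup₂ (f := fun x (_ : x ∈ ({f, g} : Set (p ⟶ q))) => F.map x) f (by simp)

theorem IsQuantaloidHom.map_le_map_iff {F : C ⥤ D} [F.Faithful] (hF : IsQuantaloidHom F) {p q : C}
    {f g : p ⟶ q} : F.map f ≤ F.map g ↔ f ≤ g := by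
  refine ⟨fun h => ?_, hF.map_le_map⟩
  have e := hF {f, g}
  rw [sSup_pair, iSup_pair, sup_eq_right.2 h] at e
  exact sup_eq_right.1 (F.map_injective e)

/-- A surjective order embedding of hom-lattices is an order isomorphism, hence preserves joins.
Every equivalence below is handled through the order alone, without computing joins such as `cl (⋁
ζᵢ)`. -/
theorem isQuantaloidHom_of_map_le_map_iff (F : C ⥤ D) [F.Full]
    (hF : ∀ {p q : C} (f g : p ⟶ q), F.map f ≤ F.map g ↔ f ≤ g) : IsQuantaloidHom F := by
  intro p q S
  refine IsLUB.unique ⟨?_, fun k hk => ?_⟩ (isLUB_biSup (s := S) (f := fun f => F.map f))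
  · rintro _ ⟨f, hf, rfl⟩
    exact (hF _ _).2 (le_sSup hf)
  · obtain ⟨k, rfl⟩ := F.map_surjective k
    exact (hF _ _).2 (sSup_le fun f hf => (hF _ _).1 (hk ⟨f, hf, rfl⟩))

theorem iso_conj_le_iff {p p' q q' : C} (e : p ≅ p') (e' : q' ≅ q) (f g : p' ⟶ q') :
    e.hom ≫ f ≫ e'.hom ≤ e.hom ≫ g ≫ e'.hom ↔ f ≤ g := by
  refine ⟨fun h => ?_, fun h => comp_mono le_rfl (comp_mono h le_rfl)⟩
  simpa using comp_mono (le_refl e.inv) (comp_mono h (le_refl e'.inv))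

/-- `F` reflects the order, and applying `F` after its inverse conjugates an arrow by the counit
isomorphisms, which preserves and reflects the order. -/
theorem IsQuantaloidEquivalence.quantaloidEquivalent_symm {F : C ⥤ D}
    (hF : IsQuantaloidEquivalence F) : QuantaloidEquivalent D C := by
  obtain ⟨hF, hE⟩ := hF
  refine ⟨F.inv, isQuantaloidHom_of_map_le_map_iff _ fun {p q} f g => ?_, inferInstance⟩
  rw [← hF.map_le_map_iff]
  have key (h : p ⟶ q) : F.map (F.inv.map h) =
      (F.asEquivalence.counitIso.app p).hom ≫ h ≫ (F.asEquivalence.counitIso.app q).symm.hom :=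
    F.asEquivalence.fun_inv_map _ _ h
  rw [key, key]
  exact iso_conj_le_iff (F.asEquivalence.counitIso.app p) (F.asEquivalence.counitIso.app q).symm f g

theorem IsQuantaloidEquivalence.op {F : C ⥤ D} (hF : IsQuantaloidEquivalence F) :
    IsQuantaloidEquivalence F.op := by
  obtain ⟨hF, hE⟩ := hF
  refine ⟨isQuantaloidHom_of_map_le_map_iff _ fun f g => ?_, inferInstance⟩
  exact hF.map_le_map_iff (f := f.unop) (g := g.unop)

theorem fullSubcategory_ι_map_le_map_iff (P : ObjectProperty C) {X Y : P.FullSubcategory}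
    (f g : X ⟶ Y) : P.ι.map f ≤ P.ι.map g ↔ f ≤ g := Iff.rfl

open Limits in
/-- In a quantaloid, products are also coproducts. -/
theorem hasCoproduct_of_hasProduct {J : Type*} (X : J → C) [HasProduct X] :
    HasCoproduct X := by
  classical
  let σ (i : J) : X i ⟶ ∏ᶜ X :=
    Pi.lift fun j => if h : i = j then eqToHom (congrArg X h) else ⊥
  have hself (i : J) : σ i ≫ Pi.π X i = 𝟙 _ := by simp [σ]
  have hne {i j : J} (h : i ≠ j) : σ i ≫ Pi.π X j = ⊥ := by simp [σ, h]
  -- Matrix calculus with `σ` as Kronecker delta: this decomposition of the identity makes an arrow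
  -- out of the product determined by its restrictions along the `σ i`, and joins play the role of
  -- sums.
  have total : (⨆ i, Pi.π X i ≫ σ i) = 𝟙 (∏ᶜ X) := by
    refine Pi.hom_ext _ _ fun j => ?_
    rw [iSup_comp, Category.id_comp]
    refine le_antisymm (iSup_le fun i => ?_) (le_iSup_of_le j ?_)
    · by_cases h : i = j
      · subst h; rw [Category.assoc, hself, Category.comp_id]
      · rw [Category.assoc, hne h, comp_bot]; exact bot_le
    · rw [Category.assoc, hself, Category.comp_id]
  refine ⟨⟨⟨Cofan.mk (∏ᶜ X) σ, Cofan.IsColimit.mk _ (fun s => ⨆ i, Pi.π X i ≫ s.inj i) ?_ ?_⟩⟩⟩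
  · intro s j
    change σ j ≫ _ = _
    rw [comp_iSup]
    refine le_antisymm (iSup_le fun i => ?_) (le_iSup_of_le j ?_)
    · by_cases h : j = i
      · subst h; rw [← Category.assoc, hself, Category.id_comp]
      · rw [← Category.assoc, hne h, bot_comp]; exact bot_le
    · rw [← Category.assoc, hself, Category.id_comp]
  · intro s m hm
    rw [← Category.id_comp m]
    change 𝟙 (∏ᶜ X) ≫ m = _
    rw [← total, iSup_comp]
    refine iSup_congr fun i => ?_
    rw [Category.assoc]
    exact congrArg _ (hm i)

end Quantaloids

variable {Q : Type u} [SmallCategory Q] [Quantaloid Q]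

/-! ### Separation, induced categories and representables. -/

namespace QCat

variable (X : QCat Q)

theorem le_hom_left {X : QCat Q} {p q : Q} {x y : X.obj p} (h : X.le x y) (z : X.obj q) :
    X.hom y z ≤ X.hom x z := by
  refine le_trans ?_ (X.comp_le x y z)
  conv_lhs => rw [← Category.id_comp (X.hom y z)]
  exact comp_mono h le_rfl

theorem le_hom_right {X : QCat Q} {p q : Q} {x y : X.obj p} (h : X.le x y) (z : X.obj q) :
    X.hom z x ≤ X.hom z y := by
  refine le_trans ?_ (X.comp_le z x y)
  conv_lhs => rw [← Category.comp_id (X.hom z x)]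
  exact comp_mono le_rfl h

theorem IsSeparated.eq_of_hom_left {X : QCat Q} (hX : X.IsSeparated) {q : Q} {s t : X.obj q}
    (h : ∀ {r : Q} (y : X.obj r), X.hom s y = X.hom t y) : s = t :=
  hX s t ((X.id_le t).trans_eq (h t).symm) ((X.id_le s).trans_eq (h s))

theorem IsSeparated.eq_of_isSup {X : QCat Q} (hX : X.IsSeparated) {q : Q} {μ : Presheaf X q}
    {s t : X.obj q} (hs : IsSup X μ s) (ht : IsSup X μ t) : s = t :=
  hX.eq_of_hom_left fun y => (hs y).trans (ht y).symm

/-- The `Q`-category induced on a family of sets by maps into a `Q`-category. -/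
abbrev induced (obj : Q → Type u) (i : ∀ {q : Q}, obj q → X.obj q) : QCat Q where
  obj := obj
  hom x y := X.hom (i x) (i y)
  id_le _ := X.id_le _
  comp_le _ _ _ := X.comp_le _ _ _

/-- The fully faithful functor from an induced `Q`-category. -/
def inducedFunctor (obj : Q → Type u) (i : ∀ {q : Q}, obj q → X.obj q) :
    QFunctor (X.induced obj i) X :=
  ⟨fun x => i x, fun _ _ => le_rfl⟩

/-- The representable presheaf `X(-, a)`, restricted along a functor. -/
def representable {X Y : QCat Q} (j : QFunctor Y X) {q : Q} (a : X.obj q) : Presheaf Y q where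
  val y := X.hom (j.map y) a
  hom_comp_le y y' := (comp_mono (j.hom_le y y') le_rfl).trans (X.comp_le _ _ _)

/-- The Yoneda embedding on elements. -/
abbrev yoneda {X : QCat Q} {q : Q} (a : X.obj q) : Presheaf X q :=
  representable (QFunctor.id X) a

/-- The Yoneda lemma: one direction evaluates at `a` using `𝟙 ≤ X(a, a)`, the other is the presheaf
law for `μ`. -/
theorem yoneda_hom {X : QCat Q} {q r : Q} (a : X.obj q) (μ : Presheaf X r) :
    (presheafCat X).hom (yoneda a) μ = μ.val a := by
  refine eq_of_forall_le_iff fun h => le_presheaf_hom.trans ⟨fun H => ?_, fun H p x => ?_⟩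
  · refine le_trans ?_ (H a)
    conv_lhs => rw [← Category.id_comp h]
    exact comp_mono (X.id_le a) le_rfl
  · exact (comp_mono le_rfl H).trans (μ.hom_comp_le x a)

end QCat

namespace QFunctor

variable {X Y : QCat Q}

/-- Suprema in a separated category are unique, so preservation need only be checked on one supremum
of each presheaf. -/
theorem isSupPreserving_of_exists (f : QFunctor X Y) (hX : X.IsSeparated)
    (h : ∀ {q : Q} (μ : Presheaf X q), ∃ s, IsSup X μ s ∧ IsSup Y (f.push μ) (f.map s)) :
    f.IsSupPreserving := by
  intro q μ s hs
  obtain ⟨t, ht, ht'⟩ := h μ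
  rwa [hX.eq_of_isSup hs ht]

/-- A functor with a right adjoint preserves suprema. -/
theorem isSupPreserving_of_adjoint (f : QFunctor X Y) (g : ∀ {q : Q}, Y.obj q → X.obj q)
    (h : ∀ {p q : Q} (x : X.obj p) (y : Y.obj q), Y.hom (f.map x) y = X.hom x (g y)) :
    f.IsSupPreserving := by
  intro q μ s hs
  refine (isSup_push_iff f).2 fun y k => ?_
  simp only [h]
  exact isSup_iff.1 hs _ _

end QFunctor

/-! ### Suprema along functors, adjoints and reflections in `QSup`. -/

namespace QSup

/-- The supremum of the image of a presheaf under a functor. -/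
noncomputable def supAlong (A : QSup Q) {D : QCat Q} (j : QFunctor D A.carrier) {q : Q}
    (μ : Presheaf D q) : A.carrier.obj q :=
  (A.complete (j.push μ)).choose

theorem isSup_supAlong (A : QSup Q) {D : QCat Q} (j : QFunctor D A.carrier) {q : Q}
    (μ : Presheaf D q) : IsSup A.carrier (j.push μ) (A.supAlong j μ) :=
  (A.complete (j.push μ)).choose_spec

theorem le_supAlong_hom (A : QSup Q) {D : QCat Q} (j : QFunctor D A.carrier) {q : Q}
    (μ : Presheaf D q) {r : Q} (y : A.carrier.obj r) (h : q ⟶ r) :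
    h ≤ A.carrier.hom (A.supAlong j μ) y ↔
      ∀ {p : Q} (x : D.obj p), μ.val x ≫ h ≤ A.carrier.hom (j.map x) y :=
  (QFunctor.isSup_push_iff j).1 (A.isSup_supAlong j μ) y h

theorem val_le_hom_supAlong (A : QSup Q) {D : QCat Q} (j : QFunctor D A.carrier) {q : Q}
    (μ : Presheaf D q) {p : Q} (x : D.obj p) :
    μ.val x ≤ A.carrier.hom (j.map x) (A.supAlong j μ) := by
  simpa using (A.le_supAlong_hom j μ _ (𝟙 q)).1 (A.carrier.id_le _) x

/-- The right adjoint of a sup-preserving functor, on elements. -/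
noncomputable def rightAdj {A B : QSup Q} (f : A ⟶ B) {q : Q} (b : B.carrier.obj q) :
    A.carrier.obj q :=
  A.supAlong (QFunctor.id _) (QCat.representable (fn f) b)

/-- The adjoint functor theorem: the right adjoint at `b` is the supremum of the presheaf `B(f-,
b)`. -/
theorem hom_rightAdj {A B : QSup Q} (f : A ⟶ B) {p q : Q} (a : A.carrier.obj p)
    (b : B.carrier.obj q) : B.carrier.hom ((fn f).map a) b = A.carrier.hom a (rightAdj f b) := by
  apply le_antisymm
  · exact A.val_le_hom_supAlong (QFunctor.id _) (QCat.representable (fn f) b) a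
  -- What remains is the counit `f (rightAdj f b) ≤ b`, which holds because `f` preserves the
  -- supremum defining `rightAdj f b`.
  · refine ((fn f).hom_le _ _).trans (QCat.le_hom_right ?_ _)
    refine ((QFunctor.isSup_push_iff (fn f)).1
      (fn_sup f _ _ (A.isSup_supAlong (QFunctor.id _) (QCat.representable (fn f) b))) b _).2 ?_
    intro p x
    rw [Category.comp_id]
    refine iSup₂_le fun r y => ?_
    exact (comp_mono ((fn f).hom_le _ _) le_rfl).trans (B.carrier.comp_le _ _ _)

theorem hom_ext {A B : QSup Q} {f g : A ⟶ B}
    (h : ∀ {q : Q} (a : A.carrier.obj q), (fn f).map a = (fn g).map a) : f = g :=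
  hom_ext' (by ext q a; exact h a)

/-- A sup-preserving functor given by an adjoint pair of maps on elements. -/
def homOfAdjoint {A B : QSup Q} (f : ∀ {q : Q}, A.carrier.obj q → B.carrier.obj q)
    (g : ∀ {q : Q}, B.carrier.obj q → A.carrier.obj q)
    (h : ∀ {p q : Q} (a : A.carrier.obj p) (b : B.carrier.obj q),
      B.carrier.hom (f a) b = A.carrier.hom a (g b)) : A ⟶ B :=
  Hom.mk
    { map := fun a => f a
      hom_le := fun {p q} a a' => by
        rw [h]
        exact QCat.le_hom_right ((B.carrier.id_le _).trans_eq (h a' (f a'))) a }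
    (QFunctor.isSupPreserving_of_adjoint _ g h)

/-- An isomorphism given by a hom-preserving bijection on elements. -/
def isoOfBijection {A B : QSup Q} (f : ∀ {q : Q}, A.carrier.obj q → B.carrier.obj q)
    (g : ∀ {q : Q}, B.carrier.obj q → A.carrier.obj q)
    (h : ∀ {p q : Q} (a : A.carrier.obj p) (a' : A.carrier.obj q),
      B.carrier.hom (f a) (f a') = A.carrier.hom a a')
    (hfg : ∀ {q : Q} (b : B.carrier.obj q), f (g b) = b)
    (hgf : ∀ {q : Q} (a : A.carrier.obj q), g (f a) = a) : A ≅ B where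
  hom := homOfAdjoint f g fun a b => by rw [← h, hfg]
  inv := homOfAdjoint g f fun b a => by rw [← h, hfg]
  hom_inv_id := hom_ext fun a => hgf a
  inv_hom_id := hom_ext fun b => hfg b

/-- A `Q`-category that is reflective in a complete one, via a fully faithful map, is complete. -/
theorem isComplete_of_reflection (A : QSup Q) (obj : Q → Type u)
    (i : ∀ {q : Q}, obj q → A.carrier.obj q) (r : ∀ {q : Q}, A.carrier.obj q → obj q)
    (h : ∀ {p q : Q} (a : A.carrier.obj p) (x : obj q),
      A.carrier.hom (i (r a)) (i x) = A.carrier.hom a (i x)) :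
    (A.carrier.induced obj i).IsComplete := by
  intro q μ
  -- The supremum is the reflection of the one computed in `A`.
  refine ⟨r (A.supAlong (A.carrier.inducedFunctor obj i) μ), isSup_iff.2 fun y k => ?_⟩
  rw [h]
  exact A.le_supAlong_hom (A.carrier.inducedFunctor obj i) μ (i y) k

end QSup

/-- The presheaf category of a `Q`-category, as an object of `Q-Sup`. -/
def presheafSup (X : QCat Q) : QSup Q where
  carrier := presheafCat X
  separated _ _ := presheaf_le_antisymm
  complete {q} Φ := by
    -- The supremum of `Φ` is the join of all presheaves `μ`, each weighted by `Φ μ`.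
    refine ⟨⟨fun x => ⨆ (r : Q) (μ : Presheaf X r), μ.val x ≫ Φ.val μ, fun x x' => ?_⟩, ?_⟩
    · simp only [comp_iSup]
      refine iSup₂_mono fun r μ => ?_
      rw [← Category.assoc]
      exact comp_mono (μ.hom_comp_le x x') le_rfl
    · refine isSup_iff.2 fun ν h => ?_
      simp only [le_iInf_iff, le_imp, iSup_comp, iSup_le_iff, Category.assoc]
      exact ⟨fun H p μ r x => H r x p μ, fun H p x r μ => H μ p x⟩

/-! ### The fully faithful functor of closed presheaves. -/

namespace QClsDist

variable {X Y Z : QClsDist Q}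

/-- The closed presheaves of a given type. -/
def ClosedPresheaf (X : QClsDist Q) (q : Q) : Type u :=
  {μ : Presheaf X.carrier q // X.c μ = μ}

/-- The closure is a reflection onto closed presheaves; this gives their completeness and lets `c`
be dropped when testing against a closed presheaf. -/
theorem hom_c_eq {q r : Q} (μ : Presheaf X.carrier q) {ν : Presheaf X.carrier r}
    (hν : X.c ν = ν) :
    (presheafCat X.carrier).hom (X.c μ) ν = (presheafCat X.carrier).hom μ ν := by
  apply le_antisymm
  · exact QCat.le_hom_left (X.cl.le_map μ) ν
  · exact (X.cl.hom_le μ ν).trans_eq (congrArg _ hν)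

/-- Continuity in the form of an equation, which makes `l ↦ c (f^* l)` compatible with composition.
-/
theorem c_star_c (f : X ⟶ Y) {q : Q} (l : Presheaf Y.carrier q) :
    X.c ((dist f).star (Y.c l)) = X.c ((dist f).star l) := by
  refine presheaf_le_antisymm (presheaf_le_iff.2 fun p x => ?_) (presheaf_le_iff.2 fun p x => ?_)
  · refine (c_mono (fun _ x => dist_cont f l x) x).trans ?_
    rw [c_c]
  · exact c_mono (fun _ x => star_mono _ (fun _ y => le_c l y) x) x

/-- The induced map is blind to the nucleus, so it is functorial for the composition and identities
of the quotient. -/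
theorem c_star_closure (f : X ⟶ Y) {q : Q} (l : Presheaf Y.carrier q) :
    X.c ((dist (closure f)).star l) = X.c ((dist f).star l) := by
  refine presheaf_le_antisymm (presheaf_le_iff.2 fun p x => ?_) (presheaf_le_iff.2 fun p x => ?_)
  · refine (c_mono (fun _ x => clDist_star_le f l x) x).trans ?_
    rw [c_c]
  · exact c_mono (fun _ x => star_le_clDist f l x) x

theorem star_yoneda (φ : QDistributor X.carrier Y.carrier) {q : Q} (y : Y.carrier.obj q) :
    φ.star (QCat.yoneda y) = φ.transpose y := by
  ext p x
  apply le_antisymm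
  · exact iSup₂_le fun q' y' => φ.right_le x y' y
  · refine le_iSup₂_of_le q y ?_
    conv_lhs => rw [← Category.comp_id ((φ.transpose y).val x)]
    exact comp_mono le_rfl (Y.carrier.id_le y)

/-- The complete `Q`-category of closed presheaves. -/
def closedPresheaves (X : QClsDist Q) : QSup Q where
  carrier := (presheafCat X.carrier).induced X.ClosedPresheaf Subtype.val
  separated _ _ h h' := Subtype.ext (presheaf_le_antisymm h h')
  complete := QSup.isComplete_of_reflection (presheafSup X.carrier) X.ClosedPresheaf Subtype.val
    (fun μ => ⟨X.c μ, c_c μ⟩) fun μ ν => hom_c_eq μ ν.2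

/-- The presheaf of arrows from the transpose of a distributor: the right adjoint of `star`. -/
def lowerStar (φ : QDistributor X.carrier Y.carrier) {q : Q} (μ : Presheaf X.carrier q) :
    Presheaf Y.carrier q where
  val y := (presheafCat X.carrier).hom (φ.transpose y) μ
  hom_comp_le y y' := by
    refine (comp_mono ?_ le_rfl).trans ((presheafCat X.carrier).comp_le _ (φ.transpose y') _)
    exact le_presheaf_hom.2 fun p x => φ.right_le x y y'

/-- By residuation, `h` lies below either side exactly when `φ(x, y) ≫ l(y) ≫ h ≤ μ(x)` for all `x`
and `y`. -/
theorem star_hom (φ : QDistributor X.carrier Y.carrier) {q r : Q} (l : Presheaf Y.carrier q)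
    (μ : Presheaf X.carrier r) :
    (presheafCat X.carrier).hom (φ.star l) μ =
      (presheafCat Y.carrier).hom l (lowerStar φ μ) := by
  refine eq_of_forall_le_iff fun h => ?_
  simp only [le_iInf_iff, le_imp, lowerStar, QDistributor.star, QDistributor.transpose, iSup_comp,
    iSup_le_iff, Category.assoc]
  exact ⟨fun H p y p' x => H p' x p y, fun H p x p' y => H p' y p x⟩

/-- Continuity transposed to the right adjoint: transposing across the adjunction and using
`c_star_c` removes the inner closure, leaving an identity hom. -/
theorem c_lowerStar (f : X ⟶ Y) {q : Q} {μ : Presheaf X.carrier q} (hμ : X.c μ = μ) :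
    Y.c (lowerStar (dist f) μ) = lowerStar (dist f) μ := by
  refine presheaf_le_antisymm ?_ (Y.cl.le_map _)
  change 𝟙 q ≤ _
  rw [← star_hom, ← hom_c_eq _ hμ, c_star_c, hom_c_eq _ hμ, star_hom]
  exact (presheafCat Y.carrier).id_le _

/-- The sup-preserving functor between closed presheaves induced by a continuous distributor. -/
def closedStar (f : X ⟶ Y) : Y.closedPresheaves ⟶ X.closedPresheaves :=
  QSup.homOfAdjoint (A := Y.closedPresheaves) (B := X.closedPresheaves)
    (fun l => ⟨X.c ((dist f).star l.1), c_c _⟩)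
    (fun μ => ⟨lowerStar (dist f) μ.1, c_lowerStar f μ.2⟩)
    fun _ μ => (hom_c_eq _ μ.2).trans (star_hom _ _ _)

theorem closedStar_map_val (f : X ⟶ Y) {q : Q} (l : Y.closedPresheaves.carrier.obj q) :
    ((QSup.fn (closedStar f)).map l).1 = X.c ((dist f).star l.1) := rfl

/-- The closure of a representable presheaf. -/
def closedYoneda (Y : QClsDist Q) {q : Q} (y : Y.carrier.obj q) :
    Y.closedPresheaves.carrier.obj q :=
  ⟨Y.c (QCat.yoneda y), c_c _⟩

/-- Recovers a closed distributor, column by column, from the functor that it induces. -/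
theorem closedStar_closedYoneda {f : X ⟶ Y} (hf : IsClosedDist f) {q : Q}
    (y : Y.carrier.obj q) :
    ((QSup.fn (closedStar f)).map (Y.closedYoneda y)).1 = (dist f).transpose y := by
  rw [closedStar_map_val]
  change X.c ((dist f).star (Y.c (QCat.yoneda y))) = _
  rw [c_star_c, star_yoneda, hf]

theorem closedStar_le_iff {f g : X ⟶ Y} (hf : IsClosedDist f) (hg : IsClosedDist g) :
    closedStar f ≤ closedStar g ↔ f ≤ g := by
  constructor
  · intro h p q x y
    have := presheaf_le_iff.1 (h (Y.closedYoneda y)) x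
    change ((QSup.fn (closedStar f)).map (Y.closedYoneda y)).1.val x ≤
      ((QSup.fn (closedStar g)).map (Y.closedYoneda y)).1.val x at this
    rwa [closedStar_closedYoneda hf, closedStar_closedYoneda hg] at this
  · intro h q l
    refine presheaf_le_iff.2 fun p x => c_mono (fun _ x => ?_) x
    exact iSup₂_mono fun q y => comp_mono (h x y) le_rfl

theorem closedYoneda_hom (Y : QClsDist Q) {q r : Q} (y : Y.carrier.obj q)
    (l : Y.closedPresheaves.carrier.obj r) :
    Y.closedPresheaves.carrier.hom (Y.closedYoneda y) l = l.1.val y :=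
  (hom_c_eq _ l.2).trans (QCat.yoneda_hom y l.1)

/-- The distributor corresponding to a functor between closed presheaves. -/
def distOfHom (φ : Y.closedPresheaves ⟶ X.closedPresheaves) :
    QDistributor X.carrier Y.carrier where
  val x y := ((QSup.fn φ).map (Y.closedYoneda y)).1.val x
  hom_comp_le x' x y y' := by
    refine (comp_mono le_rfl ?_).trans
      (((QSup.fn φ).map (Y.closedYoneda y')).1.hom_comp_le x' x)
    refine (comp_mono le_rfl ?_).trans
      (le_presheaf_hom.1 ((QSup.fn φ).hom_le (Y.closedYoneda y) (Y.closedYoneda y')) x)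
    rw [closedYoneda_hom]
    exact le_c (QCat.yoneda y') y

/-- The heart of fullness. Both sides are tested by homs into a closed `μ`, which compares the right
adjoints `lowerStar (distOfHom φ) μ` and `rightAdj φ μ`. By Yoneda for closed presheaves, the value
of the latter at `y` is the hom from `φ` of the closed representable of `y` to `μ`, which is the
value of the former. -/
theorem c_distOfHom_star (φ : Y.closedPresheaves ⟶ X.closedPresheaves) {q : Q}
    (l : Presheaf Y.carrier q) :
    X.c ((distOfHom φ).star l) = ((QSup.fn φ).map ⟨Y.c l, c_c l⟩).1 := by
  refine congrArg Subtype.val (QCat.IsSeparated.eq_of_hom_left X.closedPresheaves.separated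
    (s := ⟨X.c ((distOfHom φ).star l), c_c _⟩) fun μ => ?_)
  refine Eq.trans ?_ (QSup.hom_rightAdj φ _ μ).symm
  refine ((hom_c_eq _ μ.2).trans (star_hom _ _ _)).trans
    (Eq.trans ?_ (hom_c_eq _ (QSup.rightAdj φ μ).2).symm)
  congr 1
  ext p y
  refine Eq.trans ?_ (closedYoneda_hom Y y _)
  exact QSup.hom_rightAdj φ (Y.closedYoneda y) μ

/-- The continuous distributor corresponding to a morphism between closed presheaves. -/
def homOfClosedHom (φ : Y.closedPresheaves ⟶ X.closedPresheaves) : X ⟶ Y :=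
  Hom.mk (distOfHom φ) fun l => by
    -- After enlarging the left side by `X.c`, both sides become the value of `φ` at the closure of
    -- `l`, since `Y.c` is idempotent.
    refine QSup.carrier_le_trans _ (X.cl.le_map _) ?_
    change (presheafCat X.carrier).le (X.c _) _
    simp only [c_distOfHom_star, c_c]
    exact (presheafCat X.carrier).id_le _

theorem isClosedDist_homOfClosedHom (φ : Y.closedPresheaves ⟶ X.closedPresheaves) :
    IsClosedDist (homOfClosedHom φ) :=
  fun y => ((QSup.fn φ).map (Y.closedYoneda y)).2

theorem closedStar_homOfClosedHom (φ : Y.closedPresheaves ⟶ X.closedPresheaves) :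
    closedStar (homOfClosedHom φ) = φ := by
  refine QSup.hom_ext fun l => Subtype.ext ((c_distOfHom_star φ l.1).trans ?_)
  exact congrArg (fun l' => ((QSup.fn φ).map l').1) (Subtype.ext l.2 : (⟨Y.c l.1, c_c _⟩ :
    Y.closedPresheaves.carrier.obj _) = l)

variable (Q) in
/-- The contravariant functor taking a closure space to its closed presheaves. -/
def closedPresheafFunctor : (QClsCloDist Q)ᵒᵖ ⥤ QSup Q where
  obj X := X.unop.obj.closedPresheaves
  map f := closedStar f.unop.1
  map_id X := by
    refine QSup.hom_ext fun l => Subtype.ext ?_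
    change QClsDist.c _ ((dist (closure (𝟙 X.unop.obj))).star l.1) = l.1
    rw [c_star_closure]
    exact (congrArg _ (QDistributor.star_id l.1)).trans l.2
  map_comp {X Y Z} f g := by
    refine QSup.hom_ext fun l => Subtype.ext ?_
    change QClsDist.c _ ((dist (closure (g.unop.1 ≫ f.unop.1))).star l.1) =
      QClsDist.c _ ((dist g.unop.1).star (QClsDist.c _ ((dist f.unop.1).star l.1)))
    rw [c_star_closure, c_star_c]
    exact congrArg _ (QDistributor.star_comp (dist g.unop.1) (dist f.unop.1) l.1)

theorem closedPresheafFunctor_map_le_iff {X Y : (QClsCloDist Q)ᵒᵖ} (f g : X ⟶ Y) :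
    (closedPresheafFunctor Q).map f ≤ (closedPresheafFunctor Q).map g ↔ f ≤ g :=
  closedStar_le_iff ((closure_eq_iff _).1 f.unop.2) ((closure_eq_iff _).1 g.unop.2)

instance : (closedPresheafFunctor Q).Faithful where
  map_injective h :=
    le_antisymm ((closedPresheafFunctor_map_le_iff _ _).1 h.le)
      ((closedPresheafFunctor_map_le_iff _ _).1 h.ge)

instance : (closedPresheafFunctor Q).Full where
  map_surjective {X Y} φ :=
    ⟨Quiver.Hom.op (X := Y.unop) (Y := X.unop)
      ⟨homOfClosedHom φ, (closure_eq_iff _).2 (isClosedDist_homOfClosedHom φ)⟩,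
      closedStar_homOfClosedHom φ⟩

end QClsDist

/-! ### Complete categories as categories of closed presheaves -/

open Classical in
/-- The discrete `Q`-category on a family of sets. -/
noncomputable abbrev discreteCat (obj : Q → Type u) : QCat Q where
  obj := obj
  hom {p q} x y :=
    if h : (⟨p, x⟩ : Σ q, obj q) = ⟨q, y⟩ then eqToHom (congrArg Sigma.fst h) else ⊥
  id_le {p} x := by
    split_ifs with h
    · exact le_rfl
    · exact absurd rfl h
  comp_le {p q r} x y z := by
    by_cases h : (⟨p, x⟩ : Σ q, obj q) = ⟨q, y⟩
    · by_cases h' : (⟨q, y⟩ : Σ q, obj q) = ⟨r, z⟩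
      · rw [dif_pos h, dif_pos h', dif_pos (h.trans h'), eqToHom_trans]
      · rw [dif_neg h', comp_bot]; exact bot_le
    · rw [dif_neg h, bot_comp]; exact bot_le

theorem isDiscrete_discreteCat (obj : Q → Type u) : (discreteCat obj).IsDiscrete :=
  fun _ _ => rfl

/-- The identity on elements, as a functor from the discrete `Q`-category. -/
noncomputable def fromDiscrete (X : QCat Q) : QFunctor (discreteCat X.obj) X where
  map x := x
  hom_le {p q} x y := by
    rw [isDiscrete_discreteCat X.obj x y]
    by_cases h : (⟨p, x⟩ : Σ q, X.obj q) = ⟨q, y⟩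
    · rw [dif_pos h]
      cases h
      exact X.id_le x
    · rw [dif_neg h]
      exact bot_le

namespace QSup

variable (A : QSup Q)

/-- The discrete closure space on the elements of a complete `Q`-category, the closure of `μ` being
`A(-, sup μ)`. -/
noncomputable def discreteSpace : QClsDist Q where
  carrier := discreteCat A.carrier.obj
  cl :=
    { map := fun μ => QCat.representable (fromDiscrete A.carrier)
        (A.supAlong (fromDiscrete A.carrier) μ)
      hom_le := fun μ ν => le_presheaf_hom.2 fun p x => by
        refine (comp_mono le_rfl ?_).trans (A.carrier.comp_le _ _ _)
        rw [le_supAlong_hom]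
        intro p x
        exact (le_presheaf_hom.1 le_rfl x).trans (A.val_le_hom_supAlong _ ν x)
      le_map := fun μ => presheaf_le_iff.2 fun p x => A.val_le_hom_supAlong _ μ x
      map_map_le := fun {q} μ => presheaf_le_iff.2 fun p x => by
        refine QCat.le_hom_right ?_ _
        refine (A.le_supAlong_hom _ _ _ (𝟙 q)).2 fun x => ?_
        rw [Category.comp_id]
        rfl }

/-- An element is the supremum of everything weighted by its hom to `a`, because `a` itself occurs
with weight at least the identity. Forgetting the homs of `A` loses nothing here. -/
theorem supAlong_representable_fromDiscrete {q : Q} (a : A.carrier.obj q) :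
    A.supAlong (fromDiscrete A.carrier) (QCat.representable (fromDiscrete A.carrier) a) = a := by
  refine A.separated _ _ ?_ ?_
  · refine (A.le_supAlong_hom _ _ _ (𝟙 q)).2 fun x => ?_
    rw [Category.comp_id]
    rfl
  · exact (A.carrier.id_le a).trans (A.val_le_hom_supAlong (fromDiscrete A.carrier)
      (QCat.representable (fromDiscrete A.carrier) a) a)

/-- Restriction to the discrete category keeps the Yoneda embedding fully faithful, since evaluation
at `a` is still available. -/
theorem representable_fromDiscrete_hom {p q : Q} (a : A.carrier.obj p) (b : A.carrier.obj q) :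
    (presheafCat (discreteCat A.carrier.obj)).hom
      (QCat.representable (fromDiscrete A.carrier) a)
      (QCat.representable (fromDiscrete A.carrier) b) = A.carrier.hom a b := by
  refine eq_of_forall_le_iff fun h => le_presheaf_hom.trans ⟨fun H => ?_, fun H r x => ?_⟩
  · refine le_trans ?_ (H a)
    conv_lhs => rw [← Category.id_comp h]
    exact comp_mono (A.carrier.id_le a) le_rfl
  · exact (comp_mono le_rfl H).trans (A.carrier.comp_le _ _ _)

/-- A separated complete `Q`-category is isomorphic to the closed presheaves of its discrete
closure space. -/
noncomputable def isoClosedPresheaves : A ≅ A.discreteSpace.closedPresheaves :=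
  isoOfBijection (A := A) (B := A.discreteSpace.closedPresheaves)
    (fun a => ⟨QCat.representable (fromDiscrete A.carrier) a,
      congrArg (QCat.representable (fromDiscrete A.carrier))
        (A.supAlong_representable_fromDiscrete a)⟩)
    (fun μ => A.supAlong (fromDiscrete A.carrier) μ.1)
    (fun a b => A.representable_fromDiscrete_hom a b)
    (fun μ => Subtype.ext μ.2)
    (fun a => A.supAlong_representable_fromDiscrete a)

end QSup

/-! ### The equivalences with `QSup` and with the discrete spaces. -/

open QClsDist in
instance : ((discreteClosureSpaces Q).ι.op ⋙ closedPresheafFunctor Q).EssSurj where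
  mem_essImage A :=
    ⟨Opposite.op ⟨⟨A.discreteSpace⟩, isDiscrete_discreteCat A.carrier.obj⟩,
      ⟨A.isoClosedPresheaves.symm⟩⟩

open QClsDist in
theorem isQuantaloidEquivalence_closedPresheafFunctor :
    IsQuantaloidEquivalence (closedPresheafFunctor Q) := by
  have : (closedPresheafFunctor Q).EssSurj :=
    ⟨fun A => ⟨_, ⟨((discreteClosureSpaces Q).ι.op ⋙ closedPresheafFunctor Q).objObjPreimageIso A⟩⟩⟩
  exact ⟨isQuantaloidHom_of_map_le_map_iff _ closedPresheafFunctor_map_le_iff, {}⟩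

open QClsDist in
theorem isQuantaloidEquivalence_discrete_closedPresheafFunctor :
    IsQuantaloidEquivalence ((discreteClosureSpaces Q).ι.op ⋙ closedPresheafFunctor Q) :=
  ⟨isQuantaloidHom_of_map_le_map_iff _ fun f g =>
    closedPresheafFunctor_map_le_iff ((discreteClosureSpaces Q).ι.op.map f)
      ((discreteClosureSpaces Q).ι.op.map g), {}⟩

open QClsDist in
theorem isQuantaloidEquivalence_discreteClosureSpaces_ι :
    IsQuantaloidEquivalence (discreteClosureSpaces Q).ι := by
  refine ⟨isQuantaloidHom_of_map_le_map_iff _ (fullSubcategory_ι_map_le_map_iff _), ?_⟩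
  have : (discreteClosureSpaces Q).ι.EssSurj := ⟨fun X => by
    let F := (discreteClosureSpaces Q).ι.op ⋙ closedPresheafFunctor Q
    -- Some discrete space has closed presheaves isomorphic to those of `X`; the fully faithful
    -- functor reflects this to an isomorphism of spaces.
    let A := (closedPresheafFunctor Q).obj (Opposite.op X)
    exact ⟨(F.objPreimage A).unop,
      ⟨((closedPresheafFunctor Q).preimageIso (F.objObjPreimageIso A)).unop.symm⟩⟩⟩
  exact {}

/-! ### Limits and colimits in `QSup`. -/

namespace QSup

open Limits

section Products

variable {J : Type u} (A : J → QSup Q)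

/-- The product of `Q`-categories. -/
abbrev prodCat : QCat Q where
  obj q := ∀ i, (A i).carrier.obj q
  hom x y := ⨅ i, (A i).carrier.hom (x i) (y i)
  id_le x := le_iInf fun i => (A i).carrier.id_le (x i)
  comp_le x y z := le_iInf fun i =>
    (comp_mono (iInf_le _ i) (iInf_le _ i)).trans ((A i).carrier.comp_le (x i) (y i) (z i))

/-- The projections from the product of `Q`-categories. -/
def prodProj (i : J) : QFunctor (prodCat A) (A i).carrier :=
  ⟨fun x => x i, fun _ _ => iInf_le _ i⟩

/-- Homs in the product are meets of homs in the factors, so suprema are computed componentwise;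
completeness and sup-preservation of the projections both follow. -/
theorem isSup_prod {q : Q} (μ : Presheaf (prodCat A) q) :
    IsSup (prodCat A) μ fun i => (A i).supAlong (prodProj A i) μ := by
  refine isSup_iff.2 fun y h => ?_
  simp only [le_iInf_iff, le_supAlong_hom]
  exact ⟨fun H p x i => H i x, fun H i p x => H x i⟩

/-- The product of separated complete `Q`-categories. -/
def prodSup : QSup Q where
  carrier := prodCat A
  separated _ _ h h' := funext fun i =>
    (A i).separated _ _ (h.trans (iInf_le _ i)) (h'.trans (iInf_le _ i))
  complete μ := ⟨_, isSup_prod A μ⟩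

/-- The projections from the product in `Q-Sup`. -/
def prodπ (i : J) : prodSup A ⟶ A i :=
  Hom.mk (prodProj A i) (QFunctor.isSupPreserving_of_exists _ (prodSup A).separated fun μ =>
    ⟨_, isSup_prod A μ, (A i).isSup_supAlong (prodProj A i) μ⟩)

/-- The functor into a product given by its components. -/
def prodLift {W : QSup Q} (f : ∀ i, W ⟶ A i) : W ⟶ prodSup A :=
  Hom.mk ⟨fun w i => (fn (f i)).map w, fun w w' => le_iInf fun i => (fn (f i)).hom_le w w'⟩
    fun {q} μ s hs => by
      refine (QFunctor.isSup_push_iff _).2 fun y h => ?_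
      refine le_iInf_iff.trans ((forall_congr' fun i =>
        (QFunctor.isSup_push_iff _).1 (fn_sup (f i) μ s hs) (y i) h).trans ?_)
      exact ⟨fun H p x => le_iInf fun i => H i x, fun H i p x => (H x).trans (iInf_le _ i)⟩

instance : HasProduct A where
  exists_limit :=
    ⟨⟨Fan.mk (prodSup A) (prodπ A), Fan.IsLimit.mk _ (fun s => prodLift A s.proj)
      (fun _ _ => rfl) fun s _ hm => hom_ext fun a => funext fun i =>
        congrArg (fun k : s.pt ⟶ A i => (fn k).map a) (hm i)⟩⟩

end Products

variable {A B : QSup Q} (f g : A ⟶ B)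

section Equalizer

/-- The elements on which two functors agree. -/
def EqObj (q : Q) : Type u :=
  {a : A.carrier.obj q // (fn f).map a = (fn g).map a}

/-- The inclusion of the elements on which two functors agree. -/
abbrev eqIncl : QFunctor (A.carrier.induced (EqObj f g) Subtype.val) A.carrier :=
  A.carrier.inducedFunctor (EqObj f g) Subtype.val

/-- Both functors send this supremum to the supremum of the same family of images; homs into an
arbitrary `y` are compared through the right adjoints. -/
theorem map_supAlong_eqIncl {q : Q}
    (μ : Presheaf (A.carrier.induced (EqObj f g) Subtype.val) q) :
    (fn f).map (A.supAlong (eqIncl f g) μ) = (fn g).map (A.supAlong (eqIncl f g) μ) := by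
  refine QCat.IsSeparated.eq_of_hom_left B.separated fun y => eq_of_forall_le_iff fun h => ?_
  rw [hom_rightAdj, hom_rightAdj, le_supAlong_hom, le_supAlong_hom]
  refine forall_congr' fun p => forall_congr' fun x => ?_
  rw [← hom_rightAdj, ← hom_rightAdj]
  exact iff_of_eq (congrArg (fun b => _ ≤ B.carrier.hom b y) x.2)

theorem isSup_equalizer {q : Q}
    (μ : Presheaf (A.carrier.induced (EqObj f g) Subtype.val) q) :
    IsSup (A.carrier.induced (EqObj f g) Subtype.val) μ
      ⟨A.supAlong (eqIncl f g) μ, map_supAlong_eqIncl f g μ⟩ :=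
  isSup_iff.2 fun y h => A.le_supAlong_hom (eqIncl f g) μ (Subtype.val y) h

/-- The equalizer of sup-preserving functors. -/
def equalizerSup : QSup Q where
  carrier := A.carrier.induced (EqObj f g) Subtype.val
  separated _ _ h h' := Subtype.ext (A.separated _ _ h h')
  complete μ := ⟨_, isSup_equalizer f g μ⟩

/-- The inclusion of the equalizer. -/
def equalizerι : equalizerSup f g ⟶ A :=
  Hom.mk (eqIncl f g) (QFunctor.isSupPreserving_of_exists _ (equalizerSup f g).separated fun μ =>
    ⟨_, isSup_equalizer f g μ, A.isSup_supAlong (eqIncl f g) μ⟩)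

/-- The factorization through the equalizer. -/
def equalizerLift {W : QSup Q} (k : W ⟶ A) (hk : k ≫ f = k ≫ g) : W ⟶ equalizerSup f g :=
  Hom.mk ⟨fun w => ⟨(fn k).map w, congrArg (fun l : W ⟶ B => (fn l).map w) hk⟩, (fn k).hom_le⟩
    fun μ s hs => (QFunctor.isSup_push_iff _).2 fun y h =>
      (QFunctor.isSup_push_iff _).1 (fn_sup k μ s hs) (Subtype.val y) h

instance : HasLimit (parallelPair f g) where
  exists_limit :=
    ⟨⟨Fork.ofι (equalizerι f g) (hom_ext fun a => a.2),
      Fork.IsLimit.mk _ (fun s => equalizerLift f g s.ι s.condition)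
        (fun s => hom_ext (f := equalizerLift f g s.ι s.condition ≫ equalizerι f g) fun _ => rfl)
        fun s _ hm => hom_ext fun a => Subtype.ext
          (congrArg (fun k : s.pt ⟶ A => (fn k).map a) hm)⟩⟩

end Equalizer

/-! ### Coequalizers as equalizers of right adjoints. -/

section Coequalizer

/-- The elements seen alike by the values of two functors. -/
def CoeqObj (q : Q) : Type u :=
  {b : B.carrier.obj q // ∀ {p : Q} (a : A.carrier.obj p),
    B.carrier.hom ((fn f).map a) b = B.carrier.hom ((fn g).map a) b}

/-- The presheaf represented by the reflection of an element to `CoeqObj`. -/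
def coeqPresheaf {q : Q} (b : B.carrier.obj q) : Presheaf B.carrier q where
  -- Each `sSup` is the residual on the side opposite to `imp`: the largest `h` whose composite with
  -- `B(b, c)` lies below `B(x, c)`. The meet collects what every `c` in `CoeqObj` allows as a hom
  -- from `x` to the reflection of `b`.
  val {p} x := ⨅ (r : Q) (c : CoeqObj f g r),
    sSup {h : p ⟶ q | h ≫ B.carrier.hom b c.1 ≤ B.carrier.hom x c.1}
  hom_comp_le x x' := by
    refine le_iInf₂ fun r c => le_sSup ?_
    change (_ ≫ _) ≫ _ ≤ _
    rw [Category.assoc]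
    refine (comp_mono le_rfl ?_).trans (B.carrier.comp_le x x' c.1)
    refine (comp_mono (iInf₂_le r c) le_rfl).trans ?_
    rw [Quantaloid.sSup_comp]
    exact iSup₂_le fun _ h => h

theorem le_coeqPresheaf_val {p q : Q} (b : B.carrier.obj q) (x : B.carrier.obj p) (h : p ⟶ q) :
    h ≤ (coeqPresheaf f g b).val x ↔ ∀ {r : Q} (c : CoeqObj f g r),
      h ≫ B.carrier.hom b c.1 ≤ B.carrier.hom x c.1 := by
  refine le_iInf₂_iff.trans (forall_congr' fun r => forall_congr' fun c =>
    ⟨fun H => (comp_mono H le_rfl).trans ?_, fun H => le_sSup H⟩)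
  rw [Quantaloid.sSup_comp]
  exact iSup₂_le fun _ h => h

/-- The reflection of an element to `CoeqObj`, as an element. -/
noncomputable def coeqReflection {q : Q} (b : B.carrier.obj q) : B.carrier.obj q :=
  B.supAlong (QFunctor.id _) (coeqPresheaf f g b)

/-- The reflection property: `b` lies below its reflection because the identity satisfies the
defining inequalities, and those inequalities are what the supremum needs in order to map to `c`. -/
theorem coeqReflection_hom {q r : Q} (b : B.carrier.obj q) (c : CoeqObj f g r) :
    B.carrier.hom (coeqReflection f g b) c.1 = B.carrier.hom b c.1 := by
  apply le_antisymm
  · refine QCat.le_hom_left (le_trans ?_ (B.val_le_hom_supAlong (QFunctor.id _) _ b)) _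
    rw [le_coeqPresheaf_val]
    intro r c
    rw [Category.id_comp]
  · refine (B.le_supAlong_hom (QFunctor.id _) _ _ _).2 fun x => ?_
    exact (le_coeqPresheaf_val f g b x _).1 le_rfl c

theorem hom_coeqReflection {p q : Q} (b : B.carrier.obj q) (x : B.carrier.obj p) :
    B.carrier.hom x (coeqReflection f g b) = (coeqPresheaf f g b).val x := by
  refine le_antisymm ?_ (B.val_le_hom_supAlong (QFunctor.id _) _ x)
  rw [le_coeqPresheaf_val]
  intro r c
  rw [← coeqReflection_hom]
  exact B.carrier.comp_le _ _ _

/-- Homs into the reflection depend on the source only through its homs to elements of `CoeqObj`,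
and those cannot tell `f a` from `g a`. -/
theorem coeqReflection_mem {q : Q} (b : B.carrier.obj q) {p : Q} (a : A.carrier.obj p) :
    B.carrier.hom ((fn f).map a) (coeqReflection f g b) =
      B.carrier.hom ((fn g).map a) (coeqReflection f g b) := by
  refine eq_of_forall_le_iff fun h => ?_
  rw [hom_coeqReflection, hom_coeqReflection, le_coeqPresheaf_val, le_coeqPresheaf_val]
  exact forall_congr' fun r => forall_congr' fun c => by rw [c.2 a]

/-- The coequalizer of sup-preserving functors. -/
def coequalizerSup : QSup Q where
  carrier := B.carrier.induced (CoeqObj f g) Subtype.val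
  separated _ _ h h' := Subtype.ext (B.separated _ _ h h')
  complete := isComplete_of_reflection B (CoeqObj f g) Subtype.val
    (fun b => ⟨coeqReflection f g b, coeqReflection_mem f g b⟩) (coeqReflection_hom f g)

/-- The quotient functor to the coequalizer. -/
noncomputable def coequalizerπ : B ⟶ coequalizerSup f g :=
  homOfAdjoint (B := coequalizerSup f g)
    (fun b => ⟨coeqReflection f g b, coeqReflection_mem f g b⟩) Subtype.val
    (coeqReflection_hom f g)

theorem coequalizerπ_hom {q r : Q} (b : B.carrier.obj q)
    (c : (coequalizerSup f g).carrier.obj r) :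
    (coequalizerSup f g).carrier.hom ((fn (coequalizerπ f g)).map b) c = B.carrier.hom b c.1 :=
  coeqReflection_hom f g b c

/-- The quotient map is surjective on elements, whence the uniqueness of factorizations. -/
theorem coequalizerπ_map_val {q : Q} (c : (coequalizerSup f g).carrier.obj q) :
    (fn (coequalizerπ f g)).map c.1 = c :=
  QCat.IsSeparated.eq_of_hom_left (coequalizerSup f g).separated
    fun y => coequalizerπ_hom f g c.1 y

theorem coequalizer_condition : f ≫ coequalizerπ f g = g ≫ coequalizerπ f g :=
  hom_ext fun a => QCat.IsSeparated.eq_of_hom_left (coequalizerSup f g).separated fun c =>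
    (coequalizerπ_hom f g _ c).trans ((c.2 a).trans (coequalizerπ_hom f g _ c).symm)

variable {f g} in
-- Lets the right adjoint of `k` corestrict to `CoeqObj`; the factorization of `k` is the left
-- adjoint of this corestriction.
theorem rightAdj_mem_coeqObj {D : QSup Q} {k : B ⟶ D} (hk : f ≫ k = g ≫ k) {q : Q}
    (d : D.carrier.obj q) {p : Q} (a : A.carrier.obj p) :
    B.carrier.hom ((fn f).map a) (rightAdj k d) = B.carrier.hom ((fn g).map a) (rightAdj k d) := by
  rw [← hom_rightAdj, ← hom_rightAdj]
  exact congrArg (fun l : A ⟶ D => D.carrier.hom ((fn l).map a) d) hk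

/-- The factorization through the coequalizer. -/
noncomputable def coequalizerDesc {D : QSup Q} (k : B ⟶ D) (hk : f ≫ k = g ≫ k) :
    coequalizerSup f g ⟶ D :=
  homOfAdjoint (A := coequalizerSup f g) (fun c => (fn k).map c.1)
    (fun d => ⟨rightAdj k d, rightAdj_mem_coeqObj hk d⟩) fun c d => hom_rightAdj k c.1 d

theorem coequalizerπ_desc {D : QSup Q} (k : B ⟶ D) (hk : f ≫ k = g ≫ k) :
    coequalizerπ f g ≫ coequalizerDesc f g k hk = k := by
  refine hom_ext fun b => QCat.IsSeparated.eq_of_hom_left D.separated fun d => ?_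
  refine (hom_rightAdj k (coeqReflection f g b) d).trans (Eq.trans ?_ (hom_rightAdj k b d).symm)
  exact coeqReflection_hom f g b ⟨rightAdj k d, rightAdj_mem_coeqObj hk d⟩

instance : HasColimit (parallelPair f g) where
  exists_colimit :=
    ⟨⟨Cofork.ofπ (coequalizerπ f g) (coequalizer_condition f g),
      Cofork.IsColimit.mk _ (fun s => coequalizerDesc f g s.π s.condition)
        (fun s => coequalizerπ_desc f g s.π s.condition)
        fun s m hm => hom_ext fun c => by
          refine (congrArg (fn m).map (coequalizerπ_map_val f g c)).symm.trans ?_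
          exact congrArg (fun k : B ⟶ s.pt => (fn k).map c.1) hm⟩⟩

end Coequalizer

instance : HasLimits (QSup Q) := by
  have : HasProducts.{u} (QSup Q) := fun J =>
    ⟨fun F => hasLimit_of_iso (Discrete.natIsoFunctor (F := F)).symm⟩
  have : HasEqualizers (QSup Q) := hasEqualizers_of_hasLimit_parallelPair _
  exact has_limits_of_hasEqualizers_and_products

instance : HasColimits (QSup Q) := by
  have : HasCoproducts.{u} (QSup Q) := fun J => ⟨fun F => by
    have : HasColimit (Discrete.functor (F.obj ∘ Discrete.mk)) := hasCoproduct_of_hasProduct _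
    exact hasColimit_of_iso (Discrete.natIsoFunctor (F := F))⟩
  have : HasCoequalizers (QSup Q) := hasCoequalizers_of_hasColimit_parallelPair _
  exact has_colimits_of_hasCoequalizers_and_coproducts

end QSup

end QClo

theorem theorem4p15 (Q : Type u) [SmallCategory Q] [Quantaloid Q] :
    IsQuantaloidEquivalence (discreteClosureSpaces Q).ι ∧
    QuantaloidEquivalent (QClsCloDist Q) (QClsCloRel Q) ∧
    QuantaloidEquivalent (QClsCloRel Q)ᵒᵖ (QClsCloDist Q)ᵒᵖ ∧
    QuantaloidEquivalent (QClsCloDist Q)ᵒᵖ (QSup Q) ∧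
    QuantaloidEquivalent (QClsCloRel Q)ᵒᵖ (QSup Q) ∧
    Limits.HasLimits (QClsCloRel Q) ∧ Limits.HasColimits (QClsCloRel Q) := by
  have hι := isQuantaloidEquivalence_discreteClosureSpaces_ι (Q := Q)
  have hF := isQuantaloidEquivalence_discrete_closedPresheafFunctor (Q := Q)
  have := hF.2
  -- The equivalence is with the opposite category, so limits in `QSup` supply the colimits of
  -- `QClsCloRel`, and colimits supply its limits.
  have : Limits.HasLimits (QClsCloRel Q)ᵒᵖ := Adjunction.has_limits_of_equivalence
    ((discreteClosureSpaces Q).ι.op ⋙ QClsDist.closedPresheafFunctor Q)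
  have : Limits.HasColimits (QClsCloRel Q)ᵒᵖ := Adjunction.has_colimits_of_equivalence
    ((discreteClosureSpaces Q).ι.op ⋙ QClsDist.closedPresheafFunctor Q)
  exact ⟨hι, hι.quantaloidEquivalent_symm, ⟨_, hι.op⟩,
    ⟨_, isQuantaloidEquivalence_closedPresheafFunctor⟩, ⟨_, hF⟩,
    Limits.hasLimits_of_hasColimits_op, Limits.hasColimits_of_hasLimits_op⟩
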